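/- All digraphs are finite and simple (no loops, no parallel arcs; two opposite arcs between a pair of vertices are allowed). For $h\ge 0$, a digraph is $h$-semicomplete if for every vertex $v$ there are at most $h$ vertices $u\neq v$ such that there is no arc between $u$ and $v$ in either direction; it is semicomplete if it is $0$-semicomplete. An instance of $(k,c)$-DDP consists of a digraph $D$, $k$ requests $(s_1,t_1),\dots,(s_k,t_k)\in V(D)^2$, whose entries are called terminals, and an integer $c$; the question is whether there are directed paths $P_1,\dots,P_k$ in $D$, with $P_i$ from $s_i$ to $t_i$, such that every vertex of $D$ lies on at most $c$ of them. A vertex $v$ of $D$ is irrelevant for the instance if it is not a terminal and the instance has a solution in $D$ if and only if it has one in $D\setminus\{v\}$. A $t$-triple of $D$ consists of three pairwise disjoint sets $A=\{a_1,\dots,a_t\}$, $B=\{b_1,\dots,b_t\}$, $C=\{c_1,\dots,c_t\}$ of $t$ vertices each such that $(a_i,b_j)$, $(b_i,c_j)$ and $(c_i,a_i)$ are arcs of $D$ for all $i,j\in\{1,\dots,t\}$. **Theorem.** There are a function $f$, which assigns a positive integer $f(k,h)$ to every pair of integers $k\ge 1$ and $h\ge 0$, and an algorithm such that the following holds for all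 integers $k\geq 1$ and $h\geq 0$. Every instance of $(k,c)$-DDP with $2c>k$ on an $h$-semicomplete digraph $D$ that contains an $f(k,h)$-triple has an irrelevant vertex and, given $k$, $h$, the instance (with $D$ as an adjacency matrix) and such a triple, the algorithm finds an irrelevant vertex in $O(f(k,h)^2\cdot n^2)$ steps of a unit-cost random access machine (with addition and subtraction, without multiplication), where $n=|V(D)|$ and the implied constant is absolute. Moreover, $f(k,0)=O(2^{k\log k})$, where $\log$ is the natural logarithm. -/

import Mathlib

namespace DDP

/-! ### Digraphs -/

section Digraphs

variable {V : Type*}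

/-- No loops. (Parallel arcs cannot occur, since the arc set is a relation; a pair of opposite
arcs is allowed.) -/
def Simple (D : Digraph V) : Prop :=
  ∀ v, ¬ D.Adj v v

/-- The non-neighbors of `v`: the vertices other than `v` that are joined to `v` by no arc, in
either direction. -/
def nonNeighbors (D : Digraph V) (v : V) : Set V :=
  {u | u ≠ v ∧ ¬ D.Adj u v ∧ ¬ D.Adj v u}

/-- `D` is `h`-semicomplete: every vertex has at most `h` non-neighbors. -/
def IsSemicomplete (h : ℕ) (D : Digraph V) : Prop :=
  ∀ v, (nonNeighbors D v).encard ≤ h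

/-- A `t`-triple of `D`, given by orderings `a`, `b`, `c` of three disjoint `t`-sets `A`, `B`, `C`:
all arcs from `A` to `B`, all arcs from `B` to `C`, and the matching `c i → a i`. -/
structure IsTriple (D : Digraph V) {t : ℕ} (a b c : Fin t → V) : Prop where
  injA : Function.Injective a
  injB : Function.Injective b
  injC : Function.Injective c
  disjAB : Disjoint (Set.range a) (Set.range b)
  disjBC : Disjoint (Set.range b) (Set.range c)
  disjAC : Disjoint (Set.range a) (Set.range c)
  arcAB : ∀ i j, D.Adj (a i) (b j)
  arcBC : ∀ i j, D.Adj (b i) (c j)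
  arcCA : ∀ i, D.Adj (c i) (a i)

/-- `p` is the vertex sequence of a directed path of `D` from `x` to `y`. -/
structure IsPath (D : Digraph V) (x y : V) (p : List V) : Prop where
  chain : p.IsChain D.Adj
  nodup : p.Nodup
  head : p.head? = some x
  last : p.getLast? = some y

/-- A solution of the instance of Directed Disjoint Paths with Congestion with digraph `D`,
requests `(src i, tgt i)` for `i < k` and congestion `c`: for every request a path satisfying it,
such that every vertex is used by at most `c` of the `k` paths. -/
structure IsSolution (D : Digraph V) {k : ℕ} (src tgt : Fin k → V) (c : ℕ)
    (P : Fin k → List V) : Prop where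
  path : ∀ i, IsPath D (src i) (tgt i) (P i)
  congestion : ∀ v, {i | v ∈ P i}.encard ≤ c

/-- The instance is a yes-instance. -/
def Solvable (D : Digraph V) {k : ℕ} (src tgt : Fin k → V) (c : ℕ) : Prop :=
  ∃ P, IsSolution D src tgt c P

/-- The digraph obtained from `D` by deleting the vertex `v`. -/
def deleteVertex (D : Digraph V) (v : V) : Digraph {u : V // u ≠ v} where
  Adj x y := D.Adj x y

/-- `v` is irrelevant: it is not a terminal (so that the requests are requests of `D` without `v`),
and deleting it does not change the answer. -/
def IsIrrelevant (D : Digraph V) {k : ℕ} (src tgt : Fin k → V) (c : ℕ) (v : V) : Prop :=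
  ∃ (hs : ∀ i, src i ≠ v) (ht : ∀ i, tgt i ≠ v),
    Solvable D src tgt c ↔
      Solvable (deleteVertex D v) (fun i => ⟨src i, hs i⟩) (fun i => ⟨tgt i, ht i⟩) c

end Digraphs

/-! ### Random access machines

The machine has registers and a random access memory, all holding natural numbers. Its elementary
operations are those of the usual unit-cost random access machine with addition and (truncated)
subtraction, without multiplication. Programs are finite texts with structured control flow. -/

/-- Contents of the registers and of the memory. -/
structure State where
  reg : ℕ → ℕ
  mem : ℕ → ℕ

/-- Elementary operations. -/
inductive Op where
  /-- `reg r := a` -/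
  | const (r a : ℕ)
  /-- `reg r := reg x + reg y` -/
  | add (r x y : ℕ)
  /-- `reg r := reg x - reg y`, and `0` if this is negative -/
  | sub (r x y : ℕ)
  /-- `reg r := mem (reg x)` -/
  | load (r x : ℕ)
  /-- `mem (reg x) := reg y` -/
  | store (x y : ℕ)

/-- The effect of an elementary operation. -/
def Op.exec : Op → State → State
  | .const r a, σ => { σ with reg := Function.update σ.reg r a }
  | .add r x y, σ => { σ with reg := Function.update σ.reg r (σ.reg x + σ.reg y) }
  | .sub r x y, σ => { σ with reg := Function.update σ.reg r (σ.reg x - σ.reg y) }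
  | .load r x, σ => { σ with reg := Function.update σ.reg r (σ.mem (σ.reg x)) }
  | .store x y, σ => { σ with mem := Function.update σ.mem (σ.reg x) (σ.reg y) }

/-- Programs. The tests of `ite` and `loop` ask whether a register is nonzero. -/
inductive Program where
  | op (o : Op)
  | seq (p q : Program)
  | ite (r : ℕ) (p q : Program)
  | loop (r : ℕ) (p : Program)

/-- `Runs p σ T τ`: started in state `σ`, the program `p` halts after exactly `T` steps, in state
`τ`. Every elementary operation and every evaluation of a test is one step. -/
inductive Runs : Program → State → ℕ → State → Prop where
  | op (o : Op) (σ : State) : Runs (.op o) σ 1 (o.exec σ)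
  | seq {p q : Program} {σ τ ρ : State} {T U : ℕ} :
      Runs p σ T τ → Runs q τ U ρ → Runs (.seq p q) σ (T + U) ρ
  | ite_true {r : ℕ} {p q : Program} {σ τ : State} {T : ℕ} :
      σ.reg r ≠ 0 → Runs p σ T τ → Runs (.ite r p q) σ (T + 1) τ
  | ite_false {r : ℕ} {p q : Program} {σ τ : State} {T : ℕ} :
      σ.reg r = 0 → Runs q σ T τ → Runs (.ite r p q) σ (T + 1) τ
  | loop_done {r : ℕ} {p : Program} {σ : State} :
      σ.reg r = 0 → Runs (.loop r p) σ 1 σ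
  | loop_step {r : ℕ} {p : Program} {σ τ ρ : State} {T U : ℕ} :
      σ.reg r ≠ 0 → Runs p σ T τ → Runs (.loop r p) τ U ρ → Runs (.loop r p) σ (T + U + 1) ρ

/-- The initial state with a given input: the input is at the beginning of the memory, and
everything else is zero. -/
def State.init (input : List ℕ) : State where
  reg _ := 0
  mem i := input.getD i 0

open Classical in
/-- The adjacency matrix of `D`, row by row: the entry at position `u * n + v` is `1` if there is
an arc from `u` to `v`, and `0` otherwise. -/
noncomputable def adjacencyMatrix {n : ℕ} (D : Digraph (Fin n)) : List ℕ :=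
  List.ofFn fun x : Fin (n * n) => if D.Adj x.divNat x.modNat then 1 else 0

/-- The list of the values of a sequence of vertices. -/
def vertexList {n m : ℕ} (x : Fin m → Fin n) : List ℕ :=
  List.ofFn fun i => (x i : ℕ)

/-- The input of the algorithm: the numbers `n`, `k`, `h`, `c`, `t`, then the sources and the
targets of the requests, the three orderings of a `t`-triple and the adjacency matrix. -/
noncomputable def encode {n k t : ℕ} (h c : ℕ) (D : Digraph (Fin n)) (src tgt : Fin k → Fin n)
    (a b g : Fin t → Fin n) : List ℕ :=
  [n, k, h, c, t] ++ vertexList src ++ vertexList tgt ++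
    vertexList a ++ vertexList b ++ vertexList g ++ adjacencyMatrix D

end DDP

namespace DDP

/-! ### Walks, weights and minimal solutions -/

section Minimal

open scoped Classical
open List

variable {V : Type*}

/-! Let `v = b o` have weight 11 and every other vertex weight 1, and take a solution of minimum
total weight. The goal is an `o` for which such a solution must avoid `v`. Call a vertex saturated
if `c` paths use it. By minimality no path can be replaced by a lighter walk whose new vertices are
unsaturated (`weight_le_of_walk`); so two vertices of one path that are joined by a short detour
through unsaturated vertices other than `v` are close on that path (`idxOf_le`).

The triple provides such detours. As `k < 2c`, two saturated vertices share a path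
(`exists_common`). Hence at most `4k` of the `b j ≠ v` are saturated (`card_saturated_le`):
otherwise some path meets five of them, and either it can be shortened along an arc `g j → a j` with
unsaturated ends, or it can trade vertices with another path so that both become shorter
(`exchange`). A similar count shows that such an arc exists as soon as one `b j ≠ v` is unsaturated
(`exists_unsaturated_arc`).

Suppose that a path passes `x → v → y`. If `x` has many out-neighbors among the `b j`, or reaches
many of them through vertices that have few, then it reaches an unsaturated one in at most two steps
through unsaturated vertices (`exists_unsaturated_entry`). Otherwise `x` is blocked. If `x` is not
blocked, and `y` is not blocked in the reversed digraph, then `x ⇝ b j → g e → a e → b j' ⇝ y` is a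
detour lighter than `v`, a contradiction. Being blocked does not depend on a solution, and only few
`b j` have a blocked in-neighbor (`card_blocked_le`), so a triple of size `tripleBound k h` contains
a good `o` (`exists_not_blocked`).

The test for a good `o` is bounded counting. It is written as an expression with bounded sums, and a
compiler with a verified cost bound turns expressions into programs (`computes_compile`). A table of
the multiples of `n` makes every matrix lookup take constant time in the absence of multiplication.
With `m = tripleBound k h`, one test costs `O(n² m²)` and the naive search makes `O(m²)` tests.
Taking `f = m²` absorbs this, and `f k 0` is still only `O(k⁶)`. -/

/-- The vertex `v` counts eleven times, every other vertex once. -/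
noncomputable def weight (v : V) (p : List V) : ℕ :=
  (p.map fun u => if u = v then 11 else 1).sum

theorem weight_append (v : V) (p q : List V) : weight v (p ++ q) = weight v p + weight v q := by
  simp [weight]

theorem weight_cons (v u : V) (p : List V) :
    weight v (u :: p) = (if u = v then 11 else 1) + weight v p := by
  simp [weight]

theorem weight_le_of_sublist {v : V} {p q : List V} (h : p <+ q) : weight v p ≤ weight v q := by
  induction h with
  | slnil => exact le_rfl
  | cons a _ ih => rw [weight_cons]; omega
  | cons_cons a _ ih => rw [weight_cons, weight_cons]; omega

theorem length_le_weight (v : V) (p : List V) : p.length ≤ weight v p := by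
  induction p with
  | nil => simp
  | cons a p ih => rw [weight_cons, List.length_cons]; split_ifs <;> omega

theorem eleven_le_weight {v : V} {p : List V} (h : v ∈ p) : 11 ≤ weight v p := by
  have := weight_le_of_sublist (v := v) (List.singleton_sublist.mpr h)
  simpa [weight] using this

theorem weight_eq_length {v : V} {p : List V} (h : v ∉ p) : weight v p = p.length := by
  induction p with
  | nil => simp [weight]
  | cons a p ih =>
    simp only [List.mem_cons, not_or] at h
    rw [weight_cons, List.length_cons, ih h.2, if_neg (fun e => h.1 e.symm)]; omega

theorem weight_reverse (v : V) (p : List V) : weight v p.reverse = weight v p := by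
  simp [weight, List.sum_reverse]

/-- A walk contains a path with the same ends. -/
theorem exists_path {D : Digraph V} {x y : V} {p : List V} (hc : p.IsChain D.Adj)
    (hh : p.head? = some x) (hl : p.getLast? = some y) : ∃ q, IsPath D x y q ∧ q <+ p := by
  induction p generalizing x with
  | nil => simp at hh
  | cons z p ih =>
    obtain rfl : z = x := by simpa using hh
    cases p with
    | nil =>
      obtain rfl : z = y := by simpa using hl
      exact ⟨[z], ⟨by simp, by simp, by simp, by simp⟩, List.Sublist.refl _⟩
    | cons w p =>
      rw [List.isChain_cons_cons] at hc
      obtain ⟨q, hq, hqp⟩ := ih (x := w) hc.2 (by simp) (by simpa using hl)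
      by_cases hz : z ∈ q
      · obtain ⟨s, t, rfl⟩ := List.append_of_mem hz
        refine ⟨z :: t, ⟨?_, ?_, by simp, ?_⟩, ?_⟩
        · exact (List.isChain_append.mp hq.chain).2.1
        · exact (List.nodup_append.mp hq.nodup).2.1
        · have := hq.last
          rwa [List.getLast?_append_cons] at this
        · exact ((List.sublist_append_right s (z :: t)).trans hqp).trans (List.sublist_cons_self _ _)
      · refine ⟨z :: q, ⟨?_, ?_, by simp, ?_⟩, hqp.cons_cons z⟩
        · rw [List.isChain_cons]
          refine ⟨fun u hu => ?_, hq.chain⟩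
          rw [hq.head] at hu
          obtain rfl : w = u := by simpa using hu
          exact hc.1
        · exact List.nodup_cons.mpr ⟨hz, hq.nodup⟩
        · cases q with
          | nil => simpa using hq.head
          | cons u q => rw [List.getLast?_cons_cons]; exact hq.last

/-- The segment of `p` from `f` to `l` is replaced by `R`. Each inner vertex that is dropped saves
at least 1, and `v` saves 11. The result may repeat vertices, so it is only a walk. -/
theorem exists_splice {D : Digraph V} {x y f l v : V} {p R : List V} (hp : IsPath D x y p)
    (hf : f ∈ p) (hl : l ∈ p) (hlt : p.idxOf f < p.idxOf l)
    (hR : (f :: (R ++ [l])).IsChain D.Adj) :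
    ∃ q : List V, q.IsChain D.Adj ∧ q.head? = some x ∧ q.getLast? = some y ∧
      (∀ u ∈ q, u ∈ R ∨ u ∈ p ∧ (p.idxOf u ≤ p.idxOf f ∨ p.idxOf l ≤ p.idxOf u)) ∧
      weight v q + (p.idxOf l - p.idxOf f - 1) ≤ weight v p + weight v R ∧
      (v ∈ p → p.idxOf f < p.idxOf v → p.idxOf v < p.idxOf l →
        weight v q + 11 ≤ weight v p + weight v R) := by
  obtain ⟨s, p', rfl⟩ := List.append_of_mem hf
  have hnd := hp.nodup
  have hfs : f ∉ s := by
    intro h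
    exact (List.nodup_append.mp hnd).2.2 f h f (by simp) rfl
  have hif : (s ++ f :: p').idxOf f = s.length := by
    rw [List.idxOf_append_of_notMem hfs]; simp
  have hlp : l ∈ p' := by
    rcases List.mem_append.mp hl with h | h
    · rw [hif, List.idxOf_append_of_mem h] at hlt
      have := List.idxOf_lt_length_of_mem h
      omega
    · rcases List.mem_cons.mp h with rfl | h
      · omega
      · exact h
  obtain ⟨mid, t, rfl⟩ := List.append_of_mem hlp
  have hch := hp.chain
  have hpos : ∀ (a b : List V) (u : V), (a ++ u :: b).Nodup → (a ++ u :: b).idxOf u = a.length := by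
    intro a b u h
    rw [List.idxOf_append_of_notMem]
    · simp
    · intro h'
      exact (List.nodup_append.mp h).2.2 u h' u (by simp) rfl
  have hil : (s ++ f :: (mid ++ l :: t)).idxOf l = s.length + 1 + mid.length := by
    have := hpos (s ++ f :: mid) t l (by simpa using hnd)
    simp only [List.append_assoc, List.cons_append, List.length_append, List.length_cons] at this
    omega
  have hlens : ∀ u ∈ s, (s ++ f :: (mid ++ l :: t)).idxOf u ≤ s.length := fun u hu => by
    rw [List.idxOf_append_of_mem hu]; exact (List.idxOf_lt_length_of_mem hu).le
  refine ⟨s ++ f :: (R ++ l :: t), ?_, ?_, ?_, ?_, ?_, ?_⟩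
  · rw [List.isChain_split] at hch ⊢
    refine ⟨hch.1, ?_⟩
    have h2 := hch.2
    rw [← List.cons_append, List.isChain_split] at h2 ⊢
    exact ⟨by simpa using hR, h2.2⟩
  · have := hp.head
    cases s with
    | nil => simpa using this
    | cons a s => simpa using this
  · have := hp.last
    rw [List.getLast?_append_cons, ← List.cons_append, List.getLast?_append_cons] at this ⊢
    exact this
  · intro u hu
    rw [hif, hil]
    simp only [List.mem_append, List.mem_cons] at hu
    rcases hu with hu | rfl | hu | rfl | hu
    · exact .inr ⟨by simp [hu], .inl (hlens u hu)⟩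
    · exact .inr ⟨by simp, .inl hif.le⟩
    · exact .inl hu
    · exact .inr ⟨by simp, .inr hil.ge⟩
    · refine .inr ⟨by simp [hu], .inr ?_⟩
      obtain ⟨t1, t2, rfl⟩ := List.append_of_mem hu
      have := hpos (s ++ f :: mid ++ l :: t1) t2 u (by simpa using hnd)
      simp only [List.append_assoc, List.cons_append, List.length_append, List.length_cons] at this
      omega
  · have := length_le_weight v mid
    rw [hif, hil]
    simp only [weight_append, weight_cons]
    omega
  · intro hv h1 h2
    rw [hif] at h1
    rw [hil] at h2
    have hvm : v ∈ mid := by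
      simp only [List.mem_append, List.mem_cons] at hv
      rcases hv with hu | rfl | hu | rfl | hu
      · have := hlens v hu; omega
      · omega
      · exact hu
      · omega
      · obtain ⟨t1, t2, rfl⟩ := List.append_of_mem hu
        have := hpos (s ++ f :: mid ++ l :: t1) t2 v (by simpa using hnd)
        simp only [List.append_assoc, List.cons_append, List.length_append, List.length_cons] at this
        omega
    have := eleven_le_weight hvm
    simp only [weight_append, weight_cons]
    omega

/-! ### Rerouting in solutions of minimum weight -/

variable {D : Digraph V} {k c : ℕ} {src tgt : Fin k → V} {v : V} {P : Fin k → List V}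

/-- The number of the paths through a vertex. -/
noncomputable def usage (P : Fin k → List V) (u : V) : ℕ :=
  (Finset.univ.filter fun i => u ∈ P i).card

theorem encard_eq_usage (P : Fin k → List V) (u : V) : {i | u ∈ P i}.encard = usage P u := by
  rw [usage, ← Set.encard_coe_eq_coe_finsetCard]
  simp

/-- A solution of minimum total weight. -/
structure IsMinimal (D : Digraph V) (src tgt : Fin k → V) (c : ℕ) (v : V)
    (P : Fin k → List V) : Prop where
  sol : IsSolution D src tgt c P
  min : ∀ P', IsSolution D src tgt c P' → ∑ i, weight v (P i) ≤ ∑ i, weight v (P' i)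

theorem exists_isMinimal (v : V) (h : Solvable D src tgt c) : ∃ P, IsMinimal D src tgt c v P := by
  have hex : ∃ m, ∃ P, IsSolution D src tgt c P ∧ ∑ i, weight v (P i) = m := by
    obtain ⟨P, hP⟩ := h
    exact ⟨_, P, hP, rfl⟩
  obtain ⟨P, hP, hm⟩ := Nat.find_spec hex
  exact ⟨P, hP, fun P' hP' => hm ▸ Nat.find_min' hex ⟨P', hP', rfl⟩⟩

theorem usage_mono {P' : Fin k → List V} {u : V} (h : ∀ i, u ∈ P i → u ∈ P' i) :
    usage P u ≤ usage P' u :=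
  Finset.card_le_card fun i hi => by
    simp only [Finset.mem_filter, Finset.mem_univ, true_and] at hi ⊢
    exact h i hi

namespace IsMinimal

theorem usage_le (hP : IsMinimal D src tgt c v P) (u : V) : usage P u ≤ c := by
  have := hP.sol.congestion u
  rw [encard_eq_usage] at this
  exact_mod_cast this

/-- Walks are admissible competitors, because passing to the paths contained in them increases
neither weight nor congestion. -/
theorem le_of_walks (hP : IsMinimal D src tgt c v P) {P' : Fin k → List V}
    (hc : ∀ i, (P' i).IsChain D.Adj) (hh : ∀ i, (P' i).head? = some (src i))
    (hl : ∀ i, (P' i).getLast? = some (tgt i)) (hu : ∀ u, usage P' u ≤ c) :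
    ∑ i, weight v (P i) ≤ ∑ i, weight v (P' i) := by
  choose Q hQ hQP using fun i => exists_path (hc i) (hh i) (hl i)
  refine (hP.min Q ⟨hQ, fun u => ?_⟩).trans
    (Finset.sum_le_sum fun i _ => weight_le_of_sublist (hQP i))
  rw [encard_eq_usage]
  exact_mod_cast (usage_mono fun i h => (hQP i).subset h).trans (hu u)

/-- Replacing one path by a walk whose new vertices are not saturated. -/
theorem weight_le_of_walk (hP : IsMinimal D src tgt c v P) (i : Fin k) {q : List V}
    (hc : q.IsChain D.Adj) (hh : q.head? = some (src i)) (hl : q.getLast? = some (tgt i))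
    (hu : ∀ u ∈ q, u ∉ P i → usage P u < c) : weight v (P i) ≤ weight v q := by
  have key := hP.le_of_walks (P' := Function.update P i q) ?_ ?_ ?_ ?_
  · have h1 := Finset.add_sum_erase Finset.univ (fun j => weight v (P j)) (Finset.mem_univ i)
    have h2 := Finset.add_sum_erase Finset.univ (fun j => weight v (Function.update P i q j))
      (Finset.mem_univ i)
    have h3 : ∑ j ∈ Finset.univ.erase i, weight v (Function.update P i q j) =
        ∑ j ∈ Finset.univ.erase i, weight v (P j) :=
      Finset.sum_congr rfl fun j hj => by
        rw [Function.update_of_ne (Finset.ne_of_mem_erase hj)]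
    simp only [Function.update_self] at h2
    omega
  · intro j
    rcases eq_or_ne j i with rfl | hj
    · simpa using hc
    · simpa [hj] using (hP.sol.path j).chain
  · intro j
    rcases eq_or_ne j i with rfl | hj
    · simpa using hh
    · simpa [hj] using (hP.sol.path j).head
  · intro j
    rcases eq_or_ne j i with rfl | hj
    · simpa using hl
    · simpa [hj] using (hP.sol.path j).last
  · intro u
    by_cases huq : u ∈ q ∧ u ∉ P i
    · have hlt := hu u huq.1 huq.2
      have : (Finset.univ.filter fun j => u ∈ Function.update P i q j) ⊆
          insert i (Finset.univ.filter fun j => u ∈ P j) := by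
        intro j hj
        rcases eq_or_ne j i with rfl | hji
        · simp
        · simpa [hji] using hj
      exact ((Finset.card_le_card this).trans (Finset.card_insert_le _ _)).trans hlt
    · refine (usage_mono fun j hj => ?_).trans (hP.usage_le u)
      rcases eq_or_ne j i with rfl | hji
      · rw [Function.update_self] at hj
        by_contra h
        exact huq ⟨hj, h⟩
      · rwa [Function.update_of_ne hji] at hj

/-- Otherwise `R` could replace a segment with more inner vertices than `R` has. As `R` avoids `v`,
its weight is its length. -/
theorem idxOf_le (hP : IsMinimal D src tgt c v P) {i : Fin k} {f l : V} (R : List V)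
    (hf : f ∈ P i) (hl : l ∈ P i) (hR : (f :: (R ++ [l])).IsChain D.Adj)
    (hu : ∀ u ∈ R, usage P u < c ∧ u ≠ v) :
    (P i).idxOf l ≤ (P i).idxOf f + R.length + 1 := by
  by_contra! hlt
  obtain ⟨q, hc, hh, hla, hm, hw, -⟩ :=
    exists_splice (v := v) (hP.sol.path i) hf hl (by omega) hR
  have := hP.weight_le_of_walk i hc hh hla fun u hu' hn =>
    (hm u hu').elim (fun h => (hu u h).1) fun h => absurd h.1 hn
  rw [weight_eq_length fun h => (hu v h).2 rfl] at hw
  omega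

/-- Going around `v` saves 11, so by minimality the detour must cost at least as much. -/
theorem eleven_le (hP : IsMinimal D src tgt c v P) {i : Fin k} {f l : V} (R : List V)
    (hf : f ∈ P i) (hl : l ∈ P i) (hR : (f :: (R ++ [l])).IsChain D.Adj)
    (hu : ∀ u ∈ R, usage P u < c ∧ u ≠ v) (hv : v ∈ P i)
    (h1 : (P i).idxOf f < (P i).idxOf v) (h2 : (P i).idxOf v < (P i).idxOf l) :
    11 ≤ R.length := by
  obtain ⟨q, hc, hh, hla, hm, -, hw⟩ :=
    exists_splice (v := v) (hP.sol.path i) hf hl (by omega) hR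
  have := hP.weight_le_of_walk i hc hh hla fun u hu' hn =>
    (hm u hu').elim (fun h => (hu u h).1) fun h => absurd h.1 hn
  have hw := hw hv h1 h2
  rw [weight_eq_length (p := R) fun h => (hu v h).2 rfl] at hw
  omega

/-- Two paths that can be shortened simultaneously, each through vertices which the other one
leaves. -/
theorem exchange (hP : IsMinimal D src tgt c v P) {i j : Fin k} (hij : i ≠ j)
    {f l f' l' : V} (R R' : List V)
    (hf : f ∈ P i) (hl : l ∈ P i) (hR : (f :: (R ++ [l])).IsChain D.Adj)
    (hf' : f' ∈ P j) (hl' : l' ∈ P j) (hR' : (f' :: (R' ++ [l'])).IsChain D.Adj)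
    (hv : v ∉ R) (hv' : v ∉ R') (hRR : ∀ u ∈ R, u ∉ R')
    (hu : ∀ u ∈ R, u ∈ P j ∧ (P j).idxOf f' < (P j).idxOf u ∧ (P j).idxOf u < (P j).idxOf l')
    (hu' : ∀ u ∈ R', u ∈ P i ∧ (P i).idxOf f < (P i).idxOf u ∧ (P i).idxOf u < (P i).idxOf l)
    (h1 : (P i).idxOf f + R.length + 1 < (P i).idxOf l)
    (h2 : (P j).idxOf f' + R'.length + 1 ≤ (P j).idxOf l') : False := by
  obtain ⟨q, hc, hh, hla, hm, hw, -⟩ :=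
    exists_splice (v := v) (hP.sol.path i) hf hl (by omega) hR
  obtain ⟨q', hc', hh', hla', hm', hw', -⟩ :=
    exists_splice (v := v) (hP.sol.path j) hf' hl' (by omega) hR'
  rw [weight_eq_length hv] at hw
  rw [weight_eq_length hv'] at hw'
  set P' := Function.update (Function.update P i q) j q' with hP'
  have ei : P' i = q := by rw [hP', Function.update_of_ne hij, Function.update_self]
  have ej : P' j = q' := by rw [hP', Function.update_self]
  have eo : ∀ a, a ≠ i → a ≠ j → P' a = P a := fun a hi hj => by
    rw [hP', Function.update_of_ne hj, Function.update_of_ne hi]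
  have key := hP.le_of_walks (P' := P') ?_ ?_ ?_ ?_
  · have hsum : ∀ Q : Fin k → List V, ∑ a, weight v (Q a) = weight v (Q i) + (weight v (Q j) +
        ∑ a ∈ (Finset.univ.erase i).erase j, weight v (Q a)) := fun Q => by
      rw [Finset.add_sum_erase _ (fun a => weight v (Q a)) (by simp [hij.symm]),
        Finset.add_sum_erase _ (fun a => weight v (Q a)) (Finset.mem_univ i)]
    have h3 : ∑ a ∈ (Finset.univ.erase i).erase j, weight v (P' a) =
        ∑ a ∈ (Finset.univ.erase i).erase j, weight v (P a) :=
      Finset.sum_congr rfl fun a ha => by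
        simp only [Finset.mem_erase] at ha
        rw [eo a ha.2.1 ha.1]
    rw [hsum P, hsum P', h3, ei, ej] at key
    omega
  · intro a
    rcases eq_or_ne a i with rfl | hi
    · rwa [ei]
    · rcases eq_or_ne a j with rfl | hj
      · rwa [ej]
      · rw [eo a hi hj]; exact (hP.sol.path a).chain
  · intro a
    rcases eq_or_ne a i with rfl | hi
    · rwa [ei]
    · rcases eq_or_ne a j with rfl | hj
      · rwa [ej]
      · rw [eo a hi hj]; exact (hP.sol.path a).head
  · intro a
    rcases eq_or_ne a i with rfl | hi
    · rwa [ei]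
    · rcases eq_or_ne a j with rfl | hj
      · rwa [ej]
      · rw [eo a hi hj]; exact (hP.sol.path a).last
  · intro u
    refine le_trans ?_ (hP.usage_le u)
    -- A vertex that leaves path `b` may enter path `a` even if it is saturated: its usage does not
    -- grow.
    have hswap : ∀ a b : Fin k, a ≠ b → u ∈ P b → u ∉ P' b → (∀ e, e ≠ a → e ≠ b → P' e = P e) →
        usage P' u ≤ usage P u := by
      intro a b hab hb hb' he
      have hs : (Finset.univ.filter fun e => u ∈ P' e) ⊆
          insert a ((Finset.univ.filter fun e => u ∈ P e).erase b) := by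
        intro e hem
        simp only [Finset.mem_filter, Finset.mem_univ, true_and] at hem
        rcases eq_or_ne e a with rfl | hea
        · simp
        · have heb : e ≠ b := fun h => hb' (h ▸ hem)
          simp only [Finset.mem_insert, Finset.mem_erase, Finset.mem_filter, Finset.mem_univ,
            true_and]
          rw [he e hea heb] at hem
          exact .inr ⟨heb, hem⟩
      have hbm : b ∈ Finset.univ.filter fun e => u ∈ P e := by simpa using hb
      have := (Finset.card_le_card hs).trans (Finset.card_insert_le _ _)
      rw [Finset.card_erase_of_mem hbm] at this
      have hpos : 0 < (Finset.univ.filter fun e => u ∈ P e).card := Finset.card_pos.mpr ⟨b, hbm⟩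
      unfold usage
      omega
    by_cases hRu : u ∈ R
    · obtain ⟨hj, hj1, hj2⟩ := hu u hRu
      refine hswap i j hij hj ?_ fun e he1 he2 => eo e he1 he2
      rw [ej]
      intro h
      rcases hm' u h with h | ⟨-, h | h⟩
      · exact hRR u hRu h
      · omega
      · omega
    by_cases hRu' : u ∈ R'
    · obtain ⟨hi, hi1, hi2⟩ := hu' u hRu'
      refine hswap j i hij.symm hi ?_ fun e he1 he2 => eo e he2 he1
      rw [ei]
      intro h
      rcases hm u h with h | ⟨-, h | h⟩
      · exact hRu h
      · omega
      · omega
    refine usage_mono fun a ha => ?_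
    rcases eq_or_ne a i with rfl | hi
    · rw [ei] at ha
      exact (hm u ha).elim (fun h => absurd h hRu) fun h => h.1
    · rcases eq_or_ne a j with rfl | hj
      · rw [ej] at ha
        exact (hm' u ha).elim (fun h => absurd h hRu') fun h => h.1
      · rwa [eo a hi hj] at ha

end IsMinimal

/-! ### Reversal of arcs -/

/-- The digraph with all arcs reversed. -/
def reverse (D : Digraph V) : Digraph V where
  Adj x y := D.Adj y x

theorem IsPath.reverse {x y : V} {p : List V} (h : IsPath D x y p) :
    IsPath (reverse D) y x p.reverse where
  chain := List.isChain_reverse.mpr h.chain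
  nodup := List.nodup_reverse.mpr h.nodup
  head := by rw [List.head?_reverse]; exact h.last
  last := by rw [List.getLast?_reverse]; exact h.head

theorem IsSolution.reverse (h : IsSolution D src tgt c P) :
    IsSolution (reverse D) tgt src c fun i => (P i).reverse where
  path i := (h.path i).reverse
  congestion u := by simpa using h.congestion u

theorem usage_reverse (P : Fin k → List V) (u : V) :
    usage (fun i => (P i).reverse) u = usage P u := by
  simp [usage]

theorem IsMinimal.reverse (h : IsMinimal D src tgt c v P) :
    IsMinimal (reverse D) tgt src c v fun i => (P i).reverse where
  sol := h.sol.reverse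
  min P' hP' := by
    have := h.min _ hP'.reverse
    simpa [weight_reverse] using this

theorem IsSemicomplete.reverse {m : ℕ} (h : IsSemicomplete m D) :
    IsSemicomplete m (reverse D) := fun u => by
  have : nonNeighbors (DDP.reverse D) u = nonNeighbors D u := by
    ext w
    simp only [nonNeighbors, DDP.reverse, Set.mem_ofPred_eq]
    tauto
  rw [this]
  exact h u

/-- Reversal exchanges the outer sets and keeps the middle one, so a result on entering the `b j`
also gives one on leaving them. -/
theorem IsTriple.reverse {t : ℕ} {a b g : Fin t → V} (h : IsTriple D a b g) :
    IsTriple (reverse D) g b a where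
  injA := h.injC
  injB := h.injB
  injC := h.injA
  disjAB := h.disjBC.symm
  disjBC := h.disjAB.symm
  disjAC := h.disjAC.symm
  arcAB i j := h.arcBC j i
  arcBC i j := h.arcAB j i
  arcCA i := h.arcCA i

/-! ### Deleting a vertex -/

/-- A solution that avoids `v` is a solution of the instance without `v`. -/
theorem IsSolution.solvable_deleteVertex (h : IsSolution D src tgt c P) (hv : ∀ i, v ∉ P i)
    (hs : ∀ i, src i ≠ v) (ht : ∀ i, tgt i ≠ v) :
    Solvable (deleteVertex D v) (fun i => ⟨src i, hs i⟩) (fun i => ⟨tgt i, ht i⟩) c := by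
  have hex : ∀ i, ∃ q : List {u : V // u ≠ v}, q.map Subtype.val = P i := fun i =>
    ⟨(P i).attach.map fun u => ⟨u.1, fun e => hv i (e ▸ u.2)⟩, by
      simp [List.map_map, Function.comp_def]⟩
  choose Q hQ using hex
  refine ⟨Q, fun i => ⟨?_, ?_, ?_, ?_⟩, fun u => ?_⟩
  · have := (h.path i).chain
    rw [← hQ i, List.isChain_map] at this
    exact this
  · have := (h.path i).nodup
    rw [← hQ i] at this
    exact this.of_map
  · have := (h.path i).head
    rw [← hQ i, List.head?_map, Option.map_eq_some_iff] at this
    obtain ⟨w, hw, hw'⟩ := this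
    rw [hw]
    exact congrArg some (Subtype.ext hw')
  · have := (h.path i).last
    rw [← hQ i, List.getLast?_map, Option.map_eq_some_iff] at this
    obtain ⟨w, hw, hw'⟩ := this
    rw [hw]
    exact congrArg some (Subtype.ext hw')
  · convert h.congestion u.1 using 3
    ext i
    rw [← hQ i]
    simp [u.2]

theorem solvable_of_deleteVertex {hs : ∀ i, src i ≠ v} {ht : ∀ i, tgt i ≠ v}
    (h : Solvable (deleteVertex D v) (fun i => ⟨src i, hs i⟩) (fun i => ⟨tgt i, ht i⟩) c) :
    Solvable D src tgt c := by
  obtain ⟨Q, hQ⟩ := h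
  refine ⟨fun i => (Q i).map Subtype.val, fun i => ⟨?_, ?_, ?_, ?_⟩, fun u => ?_⟩
  · rw [List.isChain_map]; exact (hQ.path i).chain
  · exact (hQ.path i).nodup.map Subtype.val_injective
  · rw [List.head?_map, (hQ.path i).head]; rfl
  · rw [List.getLast?_map, (hQ.path i).last]; rfl
  · by_cases hu : u = v
    · have : {i | u ∈ (Q i).map Subtype.val} = ∅ := by
        ext i
        simp [hu]
      rw [this]
      simp
    · convert hQ.congestion ⟨u, hu⟩ using 3
      ext i
      simp [hu]

end Minimal

/-! ### Counting -/

section Counting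

open scoped Classical
open Finset

theorem card_le_of_spread {ι : Type*} (T : Finset ι) (pos : ι → ℕ) (s : ℕ)
    (hinj : ∀ x ∈ T, ∀ y ∈ T, pos x = pos y → x = y)
    (h : ∀ x ∈ T, ∀ y ∈ T, pos y ≤ pos x + s) : T.card ≤ s + 1 := by
  rcases T.eq_empty_or_nonempty with rfl | hne
  · simp
  obtain ⟨x, hx, hmin⟩ := T.exists_min_image pos hne
  calc T.card = (T.image pos).card := (card_image_of_injOn fun a ha b hb => hinj a ha b hb).symm
    _ ≤ (Icc (pos x) (pos x + s)).card := card_le_card fun n hn => by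
        obtain ⟨y, hy, rfl⟩ := mem_image.mp hn
        exact mem_Icc.mpr ⟨hmin y hy, h x hx y hy⟩
    _ = s + 1 := by simp; omega

/-- Five distinct positions span at least 4. The middle element is the one that will be handed over
to another path in an exchange. -/
theorem exists_spread {ι : Type*} (T : Finset ι) (pos : ι → ℕ)
    (hinj : ∀ x ∈ T, ∀ y ∈ T, pos x = pos y → x = y) (hT : 5 ≤ T.card) :
    ∃ x ∈ T, ∃ y ∈ T, ∃ z ∈ T, pos x < pos y ∧ pos y < pos z ∧ pos x + 4 ≤ pos z := by
  have hne : T.Nonempty := card_pos.mp (by omega)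
  obtain ⟨x, hx, hmin⟩ := T.exists_min_image pos hne
  obtain ⟨z, hz, hmax⟩ := T.exists_max_image pos hne
  have hne2 : ((T.erase x).erase z).Nonempty := by
    have h1 := pred_card_le_card_erase (s := T) (a := x)
    have h2 := pred_card_le_card_erase (s := T.erase x) (a := z)
    exact card_pos.mp (by omega)
  obtain ⟨y, hy⟩ := hne2
  simp only [mem_erase] at hy
  obtain ⟨hyz, hyx, hyT⟩ := hy
  refine ⟨x, hx, y, hyT, z, hz, ?_, ?_, ?_⟩
  · exact lt_of_le_of_ne (hmin y hyT) fun e => hyx (hinj _ hyT _ hx e.symm)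
  · exact lt_of_le_of_ne (hmax y hyT) fun e => hyz (hinj _ hyT _ hz e)
  · by_contra! hlt
    have := card_le_of_spread T pos 3 hinj fun u hu w hw => by
      have := hmin u hu
      have := hmax w hw
      omega
    omega

theorem card_le_of_cover {ι : Type*} {k : ℕ} (T : Finset ι) (R : Fin k → ι → Prop)
    [∀ i, DecidablePred (R i)] (s : ℕ)
    (hcov : ∀ j ∈ T, ∃ i, R i j) (hb : ∀ i, (T.filter (R i)).card ≤ s) : T.card ≤ k * s := by
  calc T.card ≤ (univ.biUnion fun i => T.filter (R i)).card := card_le_card fun j hj => by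
        obtain ⟨i, hi⟩ := hcov j hj
        exact mem_biUnion.mpr ⟨i, mem_univ _, mem_filter.mpr ⟨hj, hi⟩⟩
    _ ≤ ∑ i : Fin k, (T.filter (R i)).card := card_biUnion_le
    _ ≤ ∑ _i : Fin k, s := sum_le_sum fun i _ => hb i
    _ = k * s := by simp

end Counting

/-! ### Blocked vertices -/

section Blocked

open scoped Classical
open Finset

variable {V : Type*} {D : Digraph V} {t h : ℕ}

theorem mem_nonNeighbors {u x : V} :
    u ∈ nonNeighbors D x ↔ u ≠ x ∧ ¬ D.Adj u x ∧ ¬ D.Adj x u :=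
  Iff.rfl

theorem card_filter_nonNeighbors_le (hD : IsSemicomplete h D) (X : Finset V) (x : V) :
    (X.filter (· ∈ nonNeighbors D x)).card ≤ h := by
  have h1 : ((X.filter (· ∈ nonNeighbors D x) : Finset V) : Set V).encard ≤ h :=
    (Set.encard_le_encard fun y hy => by simpa using (mem_filter.mp hy).2).trans (hD x)
  rw [Set.encard_coe_eq_coe_finsetCard] at h1
  exact_mod_cast h1

/-- A set in which all out-degrees are small is small. -/
theorem card_le_of_outdegree_le (hD : IsSemicomplete h D) (X : Finset V) (r : ℕ)
    (hX : ∀ x ∈ X, (X.filter (D.Adj x)).card ≤ r) : X.card ≤ 2 * r + 1 + h := by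
  rcases X.eq_empty_or_nonempty with rfl | hne
  · simp
  have h1 : ∀ x ∈ X, X.card - 1 ≤
      (X.filter (D.Adj x)).card + (X.filter fun y => D.Adj y x).card + h := by
    intro x hx
    rw [← card_erase_of_mem hx]
    calc (X.erase x).card ≤ ((X.filter (D.Adj x) ∪ X.filter fun y => D.Adj y x) ∪
          X.filter (· ∈ nonNeighbors D x)).card := card_le_card fun y hy => by
            simp only [mem_erase] at hy
            simp only [mem_union, mem_filter, mem_nonNeighbors]
            tauto
      _ ≤ _ := (card_union_le _ _).trans
          (add_le_add (card_union_le _ _) (card_filter_nonNeighbors_le hD X x))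
  -- In-degrees and out-degrees inside `X` have the same sum, so the total degree is at most `2r` on
  -- average, while each is at least `|X| - 1 - h`.
  have h2 : ∑ x ∈ X, (X.filter fun y => D.Adj y x).card = ∑ x ∈ X, (X.filter (D.Adj x)).card :=
    (sum_card_bipartiteAbove_eq_sum_card_bipartiteBelow (s := X) (t := X) D.Adj).symm
  have h3 := sum_le_sum h1
  rw [sum_add_distrib, sum_add_distrib, h2] at h3
  have h4 := sum_le_sum hX
  simp only [sum_const, smul_eq_mul] at h3 h4
  have h5 : X.card * (X.card - 1) ≤ X.card * (2 * r + h) := by nlinarith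
  have := Nat.le_of_mul_le_mul_left h5 (card_pos.mpr hne)
  omega

/-- The number of out-neighbors among the `b j`. -/
noncomputable def outCount (D : Digraph V) (b : Fin t → V) (x : V) : ℕ :=
  (univ.filter fun j => D.Adj x (b j)).card

/-- The number of the `b j` that can be reached in two steps through a vertex which has at most
`s` out-neighbors among them. -/
noncomputable def reachCount (D : Digraph V) (b : Fin t → V) (s : ℕ) (x : V) : ℕ :=
  (univ.filter fun j => ∃ w, D.Adj x w ∧ D.Adj w (b j) ∧ outCount D b w ≤ s).card

/-- `x` has only few ways to enter the set of the `b j`. -/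
def Blocked (D : Digraph V) (b : Fin t → V) (s r : ℕ) (x : V) : Prop :=
  outCount D b x ≤ s ∧ reachCount D b s x ≤ r

/-- Only few of the `b j` have a blocked in-neighbor. -/
theorem card_blocked_le (hD : IsSemicomplete h D) (b : Fin t → V) (s r : ℕ) :
    (univ.filter fun j => ∃ x, D.Adj x (b j) ∧ Blocked D b s r x).card ≤
      s * (2 * r + 1 + h) := by
  rcases Nat.eq_zero_or_pos t with rfl | ht
  · simp
  set J := univ.filter fun j => ∃ x, D.Adj x (b j) ∧ Blocked D b s r x with hJ
  have hex : ∀ j, ∃ x, j ∈ J → D.Adj x (b j) ∧ Blocked D b s r x := fun j => by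
    by_cases hj : j ∈ J
    · obtain ⟨x, hx⟩ := (mem_filter.mp hj).2
      exact ⟨x, fun _ => hx⟩
    · exact ⟨b ⟨0, ht⟩, fun h => absurd h hj⟩
  choose ξ hξ using hex
  -- A blocked `x` has at most `s` out-neighbors among the `b j`, so it is `ξ j` for at most `s`
  -- indices.
  have h1 : J.card ≤ s * (J.image ξ).card := card_le_mul_card_image J s fun x hx => by
    obtain ⟨j, hj, rfl⟩ := mem_image.mp hx
    refine (card_le_card fun i hi => ?_).trans (hξ j hj).2.1
    obtain ⟨hi, hij⟩ := mem_filter.mp hi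
    rw [mem_filter]
    exact ⟨mem_univ _, hij ▸ (hξ i hi).1⟩
  refine h1.trans (Nat.mul_le_mul_left s (card_le_of_outdegree_le hD _ r fun x hx => ?_))
  obtain ⟨j, hj, rfl⟩ := mem_image.mp hx
  refine le_trans ?_ (hξ j hj).2.2
  -- An out-neighbor `y` of `x` in the image has few out-neighbors among the `b j`, and one of them
  -- is `b (ι y)`. So `ι` embeds these `y` into the indices counted by `reachCount` of `x`.
  have : ∀ y, ∃ i, y ∈ J.image ξ → i ∈ J ∧ ξ i = y := fun y => by
    by_cases hy : y ∈ J.image ξ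
    · obtain ⟨i, hi⟩ := mem_image.mp hy
      exact ⟨i, fun _ => hi⟩
    · exact ⟨j, fun h => absurd h hy⟩
  choose ι hι using this
  refine card_le_card_of_injOn ι (fun y hy => ?_) fun y hy z hz hyz => ?_
  · obtain ⟨hy, hxy⟩ := mem_filter.mp hy
    obtain ⟨hi, hiy⟩ := hι y hy
    simp only [coe_filter, Set.mem_ofPred_eq, mem_univ, true_and]
    refine ⟨y, hxy, ?_⟩
    have := hξ _ hi
    rw [hiy] at this
    exact ⟨this.1, this.2.1⟩
  · have h1 := (hι y (mem_filter.mp hy).1).2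
    have h2 := (hι z (mem_filter.mp hz).1).2
    rw [← h1, ← h2, hyz]

end Blocked

/-! ### Minimal solutions and triples -/

section Triple

open scoped Classical
open Finset

variable {V : Type*} {D : Digraph V} {k c t h : ℕ} {src tgt : Fin k → V} {v : V}
  {P : Fin k → List V} {a b g : Fin t → V}

theorem exists_mem_of_le_usage (hc : 0 < c) {u : V} (hu : c ≤ usage P u) : ∃ i, u ∈ P i := by
  obtain ⟨i, hi⟩ := card_pos.mp (hc.trans_le hu)
  exact ⟨i, (mem_filter.mp hi).2⟩

/-- As `k < 2c`, any two saturated vertices lie on a common path. -/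
theorem exists_common (hkc : k < 2 * c) {u w : V} (hu : c ≤ usage P u) (hw : c ≤ usage P w) :
    ∃ i, u ∈ P i ∧ w ∈ P i := by
  by_contra! hne
  have hd : Disjoint (univ.filter fun i => u ∈ P i) (univ.filter fun i => w ∈ P i) :=
    disjoint_filter.mpr fun i _ h1 h2 => hne i h1 h2
  have h1 := card_union_of_disjoint hd
  have h2 := card_le_univ ((univ.filter fun i => u ∈ P i) ∪ univ.filter fun i => w ∈ P i)
  rw [Fintype.card_fin] at h2
  unfold usage at hu hw
  omega

theorem idxOf_ne {p : List V} {u w : V} (hu : u ∈ p) (h : u ≠ w) :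
    p.idxOf u ≠ p.idxOf w := fun e => h ((List.idxOf_inj hu).mp e)

namespace IsTriple

theorem a_ne_b (hT : IsTriple D a b g) (i j : Fin t) : a i ≠ b j := fun e =>
  Set.disjoint_left.mp hT.disjAB ⟨i, rfl⟩ ⟨j, e.symm⟩

theorem b_ne_g (hT : IsTriple D a b g) (i j : Fin t) : b i ≠ g j := fun e =>
  Set.disjoint_left.mp hT.disjBC ⟨i, rfl⟩ ⟨j, e.symm⟩

theorem a_ne_g (hT : IsTriple D a b g) (i j : Fin t) : a i ≠ g j := fun e =>
  Set.disjoint_left.mp hT.disjAC ⟨i, rfl⟩ ⟨j, e.symm⟩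

end IsTriple

/-- Let `a p` be the first `a`, `g q` the last `g`, and `j` a third index. The arc `g j → a j`
allows `a j` to come at most one position after `g j`, which forces both of them strictly between `a
p` and `g q`. -/
theorem exists_enclosed_pair (hP : IsMinimal D src tgt c v P) (hT : IsTriple D a b g) {i : Fin k}
    {I : Finset (Fin t)} (hI : ∀ j ∈ I, a j ∈ P i ∧ g j ∈ P i) (h3 : 3 ≤ I.card) :
    ∃ p ∈ I, ∃ q ∈ I, ∃ j ∈ I,
      (P i).idxOf (a p) < (P i).idxOf (g j) ∧ (P i).idxOf (a p) < (P i).idxOf (a j) ∧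
      (P i).idxOf (g j) < (P i).idxOf (g q) ∧ (P i).idxOf (a j) < (P i).idxOf (g q) := by
  have hne : I.Nonempty := card_pos.mp (by omega)
  obtain ⟨p, hp, hmin⟩ := I.exists_min_image (fun j => (P i).idxOf (a j)) hne
  obtain ⟨q, hq, hmax⟩ := I.exists_max_image (fun j => (P i).idxOf (g j)) hne
  have hne2 : ((I.erase p).erase q).Nonempty := by
    have h1 := pred_card_le_card_erase (s := I) (a := p)
    have h2 := pred_card_le_card_erase (s := I.erase p) (a := q)
    exact card_pos.mp (by omega)
  obtain ⟨j, hj⟩ := hne2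
  simp only [mem_erase] at hj
  obtain ⟨hjq, hjp, hj⟩ := hj
  have h1 := hP.idxOf_le [] (hI j hj).2 (hI j hj).1 (by simpa using hT.arcCA j) (by simp)
  have h2 := idxOf_ne (hI p hp).1 (hT.injA.ne hjp.symm)
  have h3 := idxOf_ne (hI q hq).2 (hT.injC.ne hjq.symm)
  have h4 := idxOf_ne (hI p hp).1 (hT.a_ne_g p j)
  have h5 := idxOf_ne (hI j hj).1 (hT.a_ne_g j q)
  have h6 := hmin j hj
  have h7 := hmax j hj
  simp only [List.length_nil] at h1 h6 h7
  exact ⟨p, hp, q, hq, j, hj, by omega, by omega, by omega, by omega⟩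

theorem exists_unsaturated_pair {s1 s2 s3 : ℕ} (ht : s1 + s2 + s3 < t)
    (h1 : (univ.filter fun j => usage P (a j) < c ∧ c ≤ usage P (g j)).card ≤ s1)
    (h2 : (univ.filter fun j => c ≤ usage P (a j) ∧ usage P (g j) < c).card ≤ s2)
    (h3 : (univ.filter fun j => c ≤ usage P (a j) ∧ c ≤ usage P (g j)).card ≤ s3) :
    ∃ j, usage P (a j) < c ∧ usage P (g j) < c := by
  by_contra! hne
  have : (univ : Finset (Fin t)).card ≤ s1 + s2 + s3 := by
    refine (card_le_card fun j _ => ?_).trans ((card_union_le _ _).trans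
      (add_le_add ((card_union_le _ _).trans (add_le_add h1 h2)) h3))
    have := hne j
    simp only [mem_union, mem_filter, mem_univ, true_and]
    by_cases ha : usage P (a j) < c
    · exact .inl (.inl ⟨ha, hne j ha⟩)
    · by_cases hg : usage P (g j) < c
      · exact .inl (.inr ⟨not_lt.mp ha, hg⟩)
      · exact .inr ⟨not_lt.mp ha, not_lt.mp hg⟩
  rw [card_univ, Fintype.card_fin] at this
  omega

/-- In a minimal solution, only few of the `b j` are saturated. -/
theorem card_saturated_le (hP : IsMinimal D src tgt c v P) (hT : IsTriple D a b g)
    (hkc : k < 2 * c) (ht : 10 * k < t) (hva : ∀ j, a j ≠ v) (hvg : ∀ j, g j ≠ v) :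
    (univ.filter fun j => b j ≠ v ∧ c ≤ usage P (b j)).card ≤ k * 4 := by
  by_contra! hlt
  have hc : 0 < c := by omega
  have hexi : ∃ i, 5 ≤ ((univ.filter fun j => b j ≠ v ∧ c ≤ usage P (b j)).filter
      fun j => b j ∈ P i).card := by
    by_contra! hne
    exact absurd (card_le_of_cover _ (fun i j => b j ∈ P i) 4
      (fun j hj => exists_mem_of_le_usage hc (mem_filter.mp hj).2.2)
      fun i => Nat.lt_succ_iff.mp (hne i)) (not_le.mpr hlt)
  obtain ⟨i', hi'⟩ := hexi
  obtain ⟨j1, hj1, j2, hj2, j3, hj3, h12, h23, h13⟩ :=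
    exists_spread _ (fun j => (P i').idxOf (b j)) (fun x hx y _ e =>
      hT.injB ((List.idxOf_inj (mem_filter.mp hx).2).mp e)) hi'
  simp only [mem_filter, mem_univ, true_and] at hj1 hj2 hj3
  obtain ⟨j, hja, hjg⟩ : ∃ j, usage P (a j) < c ∧ usage P (g j) < c := by
    -- There are more than `10k` matching arcs. The indices with only `g j` saturated, only `a j`
    -- saturated, or both, number at most `4k`, `4k` and `2k`.
    refine exists_unsaturated_pair (s1 := k * 4) (s2 := k * 4) (s3 := k * 2) (by omega) ?_ ?_ ?_
    · refine card_le_of_cover _ (fun i j => g j ∈ P i ∧ b j2 ∈ P i) 4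
        (fun j hj => exists_common hkc (mem_filter.mp hj).2.2 hj2.1.2) fun i => ?_
      refine card_le_of_spread _ (fun j => (P i).idxOf (g j)) 3
        (fun x hx y _ e => hT.injC ((List.idxOf_inj (mem_filter.mp hx).2.1).mp e)) ?_
      intro x hx y hy
      simp only [mem_filter, mem_univ, true_and] at hx hy
      -- By `g x → a x → b j2` and `b j2 → g y`, the `g`'s in question lie within four consecutive
      -- positions of the path.
      have h1 := hP.idxOf_le [a x] hx.2.1 hx.2.2
        (by simpa using ⟨hT.arcCA x, hT.arcAB x j2⟩) (by simpa using ⟨hx.1.1, hva x⟩)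
      have h2 := hP.idxOf_le [] hy.2.2 hy.2.1 (by simpa using hT.arcBC j2 y) (by simp)
      simp only [List.length_nil, List.length_cons] at h1 h2
      omega
    · refine card_le_of_cover _ (fun i j => a j ∈ P i ∧ b j2 ∈ P i) 4
        (fun j hj => exists_common hkc (mem_filter.mp hj).2.1 hj2.1.2) fun i => ?_
      refine card_le_of_spread _ (fun j => (P i).idxOf (a j)) 3
        (fun x hx y _ e => hT.injA ((List.idxOf_inj (mem_filter.mp hx).2.1).mp e)) ?_
      intro x hx y hy
      simp only [mem_filter, mem_univ, true_and] at hx hy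
      have h1 := hP.idxOf_le [g y] hy.2.2 hy.2.1
        (by simpa using ⟨hT.arcBC j2 y, hT.arcCA y⟩) (by simpa using ⟨hy.1.2, hvg y⟩)
      have h2 := hP.idxOf_le [] hx.2.1 hx.2.2 (by simpa using hT.arcAB x j2) (by simp)
      simp only [List.length_nil, List.length_cons] at h1 h2
      omega
    · refine card_le_of_cover _ (fun i j => a j ∈ P i ∧ g j ∈ P i) 2
        (fun j hj => exists_common hkc (mem_filter.mp hj).2.1 (mem_filter.mp hj).2.2) fun i => ?_
      by_contra! h3
      obtain ⟨p, hp, q, hq, j, hj, e1, e2, e3, e4⟩ :=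
        exists_enclosed_pair hP hT (fun j hj => (mem_filter.mp hj).2) (Nat.succ_le_of_lt h3)
      have hp := (mem_filter.mp hp).2
      have hq := (mem_filter.mp hq).2
      have hj := (mem_filter.mp hj).2
      -- On a common path, `a p → b j1` and `b j1 → g q` would leave room for one vertex between `a
      -- p` and `g q`, but `a j` and `g j` are both there.
      have hii : i ≠ i' := by
        rintro rfl
        have f1 := hP.idxOf_le [] hp.1 hj1.2 (by simpa using hT.arcAB p j1) (by simp)
        have f2 := hP.idxOf_le [] hj1.2 hq.2 (by simpa using hT.arcBC j1 q) (by simp)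
        have f3 := idxOf_ne hj.1 (hT.a_ne_g j j)
        simp only [List.length_nil] at f1 f2
        omega
      -- Path `i` is rerouted along `a p → b j2 → g q` and path `i'` along `b j1 → g j → a j → b
      -- j3`. Each receives only vertices that the other drops, and both become shorter.
      refine hP.exchange hii [b j2] [g j, a j] hp.1 hq.2
        (by simpa using ⟨hT.arcAB p j2, hT.arcBC j2 q⟩) hj1.2 hj3.2
        (by simpa using ⟨hT.arcBC j1 j, hT.arcCA j, hT.arcAB j j3⟩)
        (by simpa using hj2.1.1.symm) (by simpa using ⟨(hvg j).symm, (hva j).symm⟩)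
        (by simpa using ⟨hT.b_ne_g j2 j, (hT.a_ne_b j j2).symm⟩)
        (by simpa using ⟨hj2.2, h12, h23⟩) (by simpa using ⟨⟨hj.2, e1, e3⟩, hj.1, e2, e4⟩) ?_ ?_
      · have f3 := idxOf_ne hj.1 (hT.a_ne_g j j)
        simp only [List.length_nil, List.length_cons]
        omega
      · simp only [List.length_nil, List.length_cons]
        omega
  -- The unsaturated arc brings `b j3` within distance 3 of `b j1`, but they are at least 4 apart.
  have := hP.idxOf_le [g j, a j] hj1.2 hj3.2
    (by simpa using ⟨hT.arcBC j1 j, hT.arcCA j, hT.arcAB j j3⟩)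
    (by simpa using ⟨⟨hjg, hvg j⟩, hja, hva j⟩)
  simp only [List.length_nil, List.length_cons] at this
  omega

/-- With an unsaturated `b j`, some matching arc `g i → a i` has both ends unsaturated. -/
theorem exists_unsaturated_arc (hP : IsMinimal D src tgt c v P) (hT : IsTriple D a b g)
    (hkc : k < 2 * c) (ht : 10 * k < t) (hva : ∀ j, a j ≠ v) (hvg : ∀ j, g j ≠ v)
    {o : Fin t} (ho : usage P (b o) < c) (hov : b o ≠ v) :
    ∃ j, usage P (a j) < c ∧ usage P (g j) < c := by
  have hc : 0 < c := by omega
  refine exists_unsaturated_pair (s1 := k * 4) (s2 := k * 4) (s3 := k * 2) (by omega) ?_ ?_ ?_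
  · refine card_le_of_cover _ (fun i j => g j ∈ P i) 4
      (fun j hj => exists_mem_of_le_usage hc (mem_filter.mp hj).2.2) fun i => ?_
    refine card_le_of_spread _ (fun j => (P i).idxOf (g j)) 3
      (fun x hx y _ e => hT.injC ((List.idxOf_inj (mem_filter.mp hx).2).mp e)) ?_
    intro x hx y hy
    simp only [mem_filter, mem_univ, true_and] at hx hy
    -- Here the unsaturated `b o` is itself part of the detour `g x → a x → b o → g y`, so no vertex
    -- shared by the paths is needed.
    exact hP.idxOf_le [a x, b o] hx.2 hy.2
      (by simpa using ⟨hT.arcCA x, hT.arcAB x o, hT.arcBC o y⟩)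
      (by simpa using ⟨⟨hx.1.1, hva x⟩, ho, hov⟩)
  · refine card_le_of_cover _ (fun i j => a j ∈ P i) 4
      (fun j hj => exists_mem_of_le_usage hc (mem_filter.mp hj).2.1) fun i => ?_
    refine card_le_of_spread _ (fun j => (P i).idxOf (a j)) 3
      (fun x hx y _ e => hT.injA ((List.idxOf_inj (mem_filter.mp hx).2).mp e)) ?_
    intro x hx y hy
    simp only [mem_filter, mem_univ, true_and] at hx hy
    exact hP.idxOf_le [b o, g y] hx.2 hy.2
      (by simpa using ⟨hT.arcAB x o, hT.arcBC o y, hT.arcCA y⟩)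
      (by simpa using ⟨⟨ho, hov⟩, hy.1.2, hvg y⟩)
  · refine card_le_of_cover _ (fun i j => a j ∈ P i ∧ g j ∈ P i) 2
      (fun j hj => exists_common hkc (mem_filter.mp hj).2.1 (mem_filter.mp hj).2.2) fun i => ?_
    by_contra! h3
    obtain ⟨p, hp, q, hq, j, hj, e1, e2, e3, e4⟩ :=
      exists_enclosed_pair hP hT (fun j hj => (mem_filter.mp hj).2) (Nat.succ_le_of_lt h3)
    have hp := (mem_filter.mp hp).2
    have hq := (mem_filter.mp hq).2
    have hj := (mem_filter.mp hj).2
    have f3 := idxOf_ne hj.1 (hT.a_ne_g j j)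
    have := hP.idxOf_le [b o] hp.1 hq.2 (by simpa using ⟨hT.arcAB p o, hT.arcBC o q⟩)
      (by simpa using ⟨ho, hov⟩)
    simp only [List.length_nil, List.length_cons] at this
    omega

/-- A vertex that is not blocked has an unsaturated way into the set of the `b j`. -/
theorem exists_unsaturated_entry (hP : IsMinimal D src tgt c v P) (hD : IsSemicomplete h D)
    (hb : Function.Injective b) (hc : 0 < c)
    (hsat : (univ.filter fun j => b j ≠ v ∧ c ≤ usage P (b j)).card ≤ k * 4)
    {i₀ : Fin k} (hv : v ∈ P i₀) {x : V}
    (hx : ¬ Blocked D b (4 * k + 1) (k * (4 * (4 * k + 1) + h + 1) + (4 * k + 1)) x) :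
    ∃ j, usage P (b j) < c ∧ b j ≠ v ∧
      (D.Adj x (b j) ∨ ∃ w, usage P w < c ∧ w ≠ v ∧ D.Adj x w ∧ D.Adj w (b j)) := by
  set s := 4 * k + 1 with hs
  -- The unusable indices: at most `4k` saturated ones, and possibly the one of `v`.
  have hF : (univ.filter fun j => b j = v ∨ c ≤ usage P (b j)).card ≤ s := by
    have h1 : (univ.filter fun j => b j = v).card ≤ 1 :=
      card_le_one.mpr fun x hx y hy =>
        hb ((mem_filter.mp hx).2.trans (mem_filter.mp hy).2.symm)
    have h2 : (univ.filter fun j => b j = v ∨ c ≤ usage P (b j)) ⊆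
        (univ.filter fun j => b j ≠ v ∧ c ≤ usage P (b j)) ∪ univ.filter fun j => b j = v := by
      intro j hj
      simp only [mem_union, mem_filter, mem_univ, true_and] at hj ⊢
      tauto
    have := (card_le_card h2).trans (card_union_le _ _)
    omega
  rw [Blocked, not_and_or, not_le, not_le] at hx
  rcases hx with hx | hx
  · obtain ⟨j, hj, hjF⟩ := exists_mem_notMem_of_card_lt_card (hF.trans_lt hx)
    simp only [mem_filter, mem_univ, true_and, not_or, not_le] at hj hjF
    exact ⟨j, hjF.2, hjF.1, .inl hj⟩
  -- If there is no entry, every usable `b j` in question is reached through some `w j` lying on a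
  -- path: either it is saturated, or it is `v`, which lies on path `i₀`. It remains to show that
  -- each path accounts for at most `4s + h + 1` indices.
  by_contra! hne
  set G := (univ.filter fun j => ∃ w, D.Adj x w ∧ D.Adj w (b j) ∧ outCount D b w ≤ s) \
    univ.filter fun j => b j = v ∨ c ≤ usage P (b j) with hG
  have hGc : k * (4 * s + h + 1) < G.card := by
    have := le_card_sdiff (univ.filter fun j => b j = v ∨ c ≤ usage P (b j))
      (univ.filter fun j => ∃ w, D.Adj x w ∧ D.Adj w (b j) ∧ outCount D b w ≤ s)
    rw [← hG] at this
    unfold reachCount at hx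
    omega
  have hmem : ∀ j ∈ G, usage P (b j) < c ∧ b j ≠ v ∧
      ∃ w, D.Adj w (b j) ∧ outCount D b w ≤ s ∧ ∃ i, w ∈ P i := by
    intro j hj
    simp only [hG, mem_sdiff, mem_filter, mem_univ, true_and, not_or, not_le] at hj
    obtain ⟨⟨w, h1, h2, h3⟩, h4, h5⟩ := hj
    refine ⟨h5, h4, w, h2, h3, ?_⟩
    by_cases hwv : w = v
    · exact ⟨i₀, hwv ▸ hv⟩
    · by_cases hw : usage P w < c
      · exact absurd h2 ((hne j h5 h4).2 w hw hwv h1)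
      · exact exists_mem_of_le_usage hc (not_lt.mp hw)
  have hex : ∀ j, ∃ w, j ∈ G → D.Adj w (b j) ∧ outCount D b w ≤ s ∧ ∃ i, w ∈ P i := fun j => by
    by_cases hj : j ∈ G
    · obtain ⟨-, -, w, hw⟩ := hmem j hj
      exact ⟨w, fun _ => hw⟩
    · exact ⟨v, fun h => absurd h hj⟩
  choose w hw using hex
  refine absurd (card_le_of_cover G (fun i j => w j ∈ P i) (4 * s + h + 1)
    (fun j hj => (hw j hj).2.2) fun i => ?_) (not_le.mpr hGc)
  set Gi := G.filter fun j => w j ∈ P i with hGi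
  change Gi.card ≤ _
  rcases Gi.eq_empty_or_nonempty with he | hGne
  · rw [he]; simp
  -- Let `w q` be the last of these vertices on path `i`. Each `b j` is an in-neighbor, an
  -- out-neighbor or a non-neighbor of `w q`, or `w q` itself. These cases contain at most `3s`,
  -- `s`, `h` and `1` indices.
  obtain ⟨q, hq, hmax⟩ := Gi.exists_max_image (fun j => (P i).idxOf (w j)) hGne
  have hq' := mem_filter.mp hq
  have hsub : Gi ⊆ ((Gi.filter fun j => (P i).idxOf (w q) ≤ (P i).idxOf (w j) + 2) ∪
      univ.filter fun j => D.Adj (w q) (b j)) ∪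
      ((univ.filter fun j => b j ∈ nonNeighbors D (w q)) ∪ univ.filter fun j => b j = w q) := by
    intro j hj
    have hj' := mem_filter.mp hj
    simp only [mem_union, mem_filter, mem_univ, true_and, mem_nonNeighbors]
    by_cases hadj : D.Adj (b j) (w q)
    · refine .inl (.inl ⟨hj, ?_⟩)
      obtain ⟨h1, h2, -⟩ := hmem j hj'.1
      exact hP.idxOf_le [b j] hj'.2 hq'.2 (by simpa using ⟨(hw j hj'.1).1, hadj⟩)
        (by simpa using ⟨h1, h2⟩)
    · tauto
  -- The detour `w j → b j → w q` puts `w j` among the three positions ending at `w q`, and each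
  -- vertex there is `w j` for at most `s` indices.
  have hA : (Gi.filter fun j => (P i).idxOf (w q) ≤ (P i).idxOf (w j) + 2).card ≤ s * 3 := by
    have h1 := card_le_mul_card_image
      (Gi.filter fun j => (P i).idxOf (w q) ≤ (P i).idxOf (w j) + 2) (f := w) s fun y hy => by
        obtain ⟨j, hj, rfl⟩ := mem_image.mp hy
        have hjG := (mem_filter.mp (mem_filter.mp hj).1).1
        refine (card_le_card fun l hl => ?_).trans (hw j hjG).2.1
        obtain ⟨hl, hlj⟩ := mem_filter.mp hl
        have hlG := (mem_filter.mp (mem_filter.mp hl).1).1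
        rw [mem_filter]
        exact ⟨mem_univ _, hlj ▸ (hw l hlG).1⟩
    refine h1.trans (Nat.mul_le_mul_left s (card_le_of_spread _ (fun y => (P i).idxOf y) 2 ?_ ?_))
    · intro y hy z _ e
      obtain ⟨j, hj, rfl⟩ := mem_image.mp hy
      exact (List.idxOf_inj (mem_filter.mp (mem_filter.mp hj).1).2).mp e
    · intro y hy z hz
      obtain ⟨j, hj, rfl⟩ := mem_image.mp hy
      obtain ⟨l, hl, rfl⟩ := mem_image.mp hz
      have h1 := (mem_filter.mp hj).2
      have h2 := hmax l (mem_filter.mp hl).1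
      omega
  have hB : (univ.filter fun j => D.Adj (w q) (b j)).card ≤ s := (hw q hq'.1).2.1
  have hC : (univ.filter fun j => b j ∈ nonNeighbors D (w q)).card ≤ h := by
    rw [← card_image_of_injective _ hb]
    refine (card_le_card fun y hy => ?_).trans
      (card_filter_nonNeighbors_le hD (univ.image b) (w q))
    obtain ⟨j, hj, rfl⟩ := mem_image.mp hy
    exact mem_filter.mpr ⟨mem_image_of_mem _ (mem_univ _), (mem_filter.mp hj).2⟩
  have hE : (univ.filter fun j => b j = w q).card ≤ 1 :=
    card_le_one.mpr fun x hx y hy =>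
      hb ((mem_filter.mp hx).2.trans (mem_filter.mp hy).2.symm)
  have := (card_le_card hsub).trans ((card_union_le _ _).trans
    (add_le_add (card_union_le _ _) (card_union_le _ _)))
  omega

/-! ### The choice of the irrelevant vertex -/

/-- The bound on `outCount` in the definition of blocked vertices. -/
def outBound (k : ℕ) : ℕ := 4 * k + 1

/-- The bound on `reachCount` in the definition of blocked vertices. -/
def reachBound (k h : ℕ) : ℕ := k * (4 * (4 * k + 1) + h + 1) + (4 * k + 1)

theorem exists_neighbors {x y : V} {p : List V} (hp : IsPath D x y p) (hv : v ∈ p) (hx : x ≠ v)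
    (hy : y ≠ v) : ∃ x' ∈ p, ∃ y' ∈ p, D.Adj x' v ∧ D.Adj v y' ∧
      p.idxOf x' < p.idxOf v ∧ p.idxOf v < p.idxOf y' := by
  obtain ⟨s, r, rfl⟩ := List.append_of_mem hv
  have hnd := hp.nodup
  have hch := hp.chain
  have hhd := hp.head
  have hla := hp.last
  rcases s.eq_nil_or_concat with rfl | ⟨s, x', rfl⟩
  · exact absurd (by simpa using hhd.symm) hx
  cases r with
  | nil => exact absurd (by simpa using hla.symm) hy
  | cons y' r =>
    simp only [List.concat_eq_append, List.append_assoc, List.cons_append, List.nil_append]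
      at hnd hch ⊢
    have hch' := (List.isChain_append.mp hch).2.1
    rw [List.isChain_cons_cons, List.isChain_cons_cons] at hch'
    have hn := List.nodup_append.mp hnd
    have hx's : x' ∉ s := fun hm => hn.2.2 x' hm x' (by simp) rfl
    have hvs : v ∉ s := fun hm => hn.2.2 v hm v (by simp) rfl
    have hy's : y' ∉ s := fun hm => hn.2.2 y' hm y' (by simp) rfl
    have hn2 := hn.2.1
    simp only [List.nodup_cons, List.mem_cons, not_or] at hn2
    refine ⟨x', by simp, y', by simp, hch'.1, hch'.2.1, ?_, ?_⟩
    · rw [List.idxOf_append_of_notMem hx's, List.idxOf_append_of_notMem hvs, List.idxOf_cons_self,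
        List.idxOf_cons_ne _ hn2.1.1]
      omega
    · rw [List.idxOf_append_of_notMem hy's, List.idxOf_append_of_notMem hvs,
        List.idxOf_cons_ne _ hn2.1.1, List.idxOf_cons_self, List.idxOf_cons_ne _ hn2.1.2.1,
        List.idxOf_cons_ne _ hn2.2.1.1]
      omega

/-- A non-terminal `b o` whose in-neighbors are not blocked and whose out-neighbors are not
blocked in the reversed digraph is irrelevant. -/
theorem isIrrelevant_of_not_blocked (hT : IsTriple D a b g) (hD : IsSemicomplete h D)
    (hkc : k < 2 * c) (ht : 10 * k + 1 < t) {o : Fin t} (hs : ∀ i, src i ≠ b o)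
    (htg : ∀ i, tgt i ≠ b o)
    (hin : ∀ x, D.Adj x (b o) → ¬ Blocked D b (outBound k) (reachBound k h) x)
    (hout : ∀ y, D.Adj (b o) y → ¬ Blocked (reverse D) b (outBound k) (reachBound k h) y) :
    IsIrrelevant D src tgt c (b o) := by
  refine ⟨hs, htg, fun hsol => ?_, solvable_of_deleteVertex⟩
  have hc : 0 < c := by omega
  obtain ⟨P, hP⟩ := exists_isMinimal (b o) hsol
  refine hP.sol.solvable_deleteVertex (fun i hvi => ?_) hs htg
  have hva := fun j => hT.a_ne_b j o
  have hvg := fun j => (hT.b_ne_g o j).symm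
  have hsat := card_saturated_le hP hT hkc (by omega) hva hvg
  obtain ⟨x, hx, y, hy, hxv, hvy, hlt1, hlt2⟩ :=
    exists_neighbors (hP.sol.path i) hvi (hs i) (htg i)
  obtain ⟨j, hj, hjv, hxj⟩ :=
    exists_unsaturated_entry hP hD hT.injB hc hsat hvi (hin x hxv)
  obtain ⟨j', hj', hjv', hyj⟩ :=
    exists_unsaturated_entry hP.reverse hD.reverse hT.injB hc
      (by simpa only [usage_reverse] using hsat) (i₀ := i) (by simpa using hvi) (hout y hvy)
  simp only [usage_reverse] at hj' hyj
  obtain ⟨e, hea, heg⟩ := exists_unsaturated_arc hP hT hkc (by omega) hva hvg hj hjv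
  have hR : ∃ R : List V, R.length ≤ 2 ∧ (∀ u ∈ R, usage P u < c ∧ u ≠ b o) ∧
      (x :: (R ++ [g e])).IsChain D.Adj := by
    rcases hxj with h1 | ⟨w, h1, h2, h3, h4⟩
    · exact ⟨[b j], by simp, by simpa using ⟨hj, hjv⟩, by simpa using ⟨h1, hT.arcBC j e⟩⟩
    · exact ⟨[w, b j], by simp, by simpa using ⟨⟨h1, h2⟩, hj, hjv⟩,
        by simpa using ⟨h3, h4, hT.arcBC j e⟩⟩
  have hR' : ∃ R : List V, R.length ≤ 2 ∧ (∀ u ∈ R, usage P u < c ∧ u ≠ b o) ∧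
      (a e :: (R ++ [y])).IsChain D.Adj := by
    rcases hyj with h1 | ⟨w, h1, h2, h3, h4⟩
    · exact ⟨[b j'], by simp, by simpa using ⟨hj', hjv'⟩, by simpa using ⟨hT.arcAB e j', h1⟩⟩
    · exact ⟨[b j', w], by simp, by simpa using ⟨⟨hj', hjv'⟩, h1, h2⟩,
        by simpa using ⟨hT.arcAB e j', h4, h3⟩⟩
  obtain ⟨R, hR1, hR2, hR3⟩ := hR
  obtain ⟨R', hR1', hR2', hR3'⟩ := hR'
  -- The detour around `b o` has at most `2 + 2 + 2 = 6` inner vertices, fewer than 11.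
  have := hP.eleven_le (R ++ g e :: a e :: R') hx hy ?_ ?_ hvi hlt1 hlt2
  · simp only [List.length_append, List.length_cons] at this
    omega
  · have e1 : x :: ((R ++ g e :: a e :: R') ++ [y]) = (x :: R) ++ g e :: (a e :: (R' ++ [y])) := by
      simp
    rw [e1, List.isChain_split, List.isChain_cons_cons]
    exact ⟨hR3, hT.arcCA e, hR3'⟩
  · intro u hu
    simp only [List.mem_append, List.mem_cons] at hu
    rcases hu with hu | rfl | rfl | hu
    · exact hR2 u hu
    · exact ⟨heg, hvg e⟩
    · exact ⟨hea, hva e⟩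
    · exact hR2' u hu

/-- A size of triples that suffices. -/
def tripleBound (k h : ℕ) : ℕ :=
  2 * (outBound k * (2 * reachBound k h + 1 + h)) + 2 * k + 10 * k + 2

/-- The summands of `tripleBound` account for the indices lost to blocked vertices in the two
directions and for the `2k` terminals. What remains is positive, and its size `10k + 2` also meets
the demand of `isIrrelevant_of_not_blocked`. -/
theorem exists_not_blocked (hb : Function.Injective b) (hD : IsSemicomplete h D)
    (ht : tripleBound k h ≤ t) (src tgt : Fin k → V) :
    ∃ o, (∀ i, src i ≠ b o) ∧ (∀ i, tgt i ≠ b o) ∧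
      (∀ x, D.Adj x (b o) → ¬ Blocked D b (outBound k) (reachBound k h) x) ∧
      ∀ y, D.Adj (b o) y → ¬ Blocked (reverse D) b (outBound k) (reachBound k h) y := by
  by_contra! hne
  have h1 := card_blocked_le hD b (outBound k) (reachBound k h)
  have h2 := card_blocked_le hD.reverse b (outBound k) (reachBound k h)
  have hterm : ∀ q : Fin k → V, (univ.filter fun o => ∃ i, q i = b o).card ≤ k := fun q => by
    rw [← card_image_of_injective _ hb]
    calc _ ≤ (univ.image q).card := card_le_card fun y hy => by
          obtain ⟨o, ho, rfl⟩ := mem_image.mp hy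
          obtain ⟨i, hi⟩ := (mem_filter.mp ho).2
          exact mem_image.mpr ⟨i, mem_univ _, hi⟩
      _ ≤ k := card_image_le.trans (by simp)
  have hcov : (univ : Finset (Fin t)) ⊆
      ((univ.filter fun o => ∃ i, src i = b o) ∪ (univ.filter fun o => ∃ i, tgt i = b o)) ∪
      ((univ.filter fun o => ∃ x, D.Adj x (b o) ∧ Blocked D b (outBound k) (reachBound k h) x) ∪
      univ.filter fun o => ∃ x, (reverse D).Adj x (b o) ∧
        Blocked (reverse D) b (outBound k) (reachBound k h) x) := by
    intro o _
    simp only [mem_union, mem_filter, mem_univ, true_and]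
    by_contra! h
    obtain ⟨⟨hs, ht⟩, hi, ho⟩ := h
    obtain ⟨y, hy, hy'⟩ := hne o hs ht hi
    exact ho y hy hy'
  have := (card_le_card hcov).trans ((card_union_le _ _).trans
    (add_le_add (card_union_le _ _) (card_union_le _ _)))
  have := hterm src
  have := hterm tgt
  rw [card_univ, Fintype.card_fin] at *
  unfold tripleBound at ht
  omega

end Triple

/-! ### Compiling expressions -/

/-- Expressions with bounded sums. The variable `var j` refers to the `j`-th entry of the context;
`letE` and `sum` append an entry to the context. -/
inductive Arith where
  | var (j : ℕ)
  | lit (a : ℕ)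
  | add (e f : Arith)
  | sub (e f : Arith)
  | load (e : Arith)
  | ite (e f g : Arith)
  | letE (e f : Arith)
  | sum (e f : Arith)

namespace Arith

open Finset

/-- The value of an expression. -/
def eval (mem : ℕ → ℕ) : List ℕ → Arith → ℕ
  | ρ, var j => ρ.getD j 0
  | _, lit a => a
  | ρ, add e f => eval mem ρ e + eval mem ρ f
  | ρ, sub e f => eval mem ρ e - eval mem ρ f
  | ρ, load e => mem (eval mem ρ e)
  | ρ, ite e f g => if eval mem ρ e ≠ 0 then eval mem ρ f else eval mem ρ g
  | ρ, letE e f => eval mem (ρ ++ [eval mem ρ e]) f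
  | ρ, sum e f => ∑ i ∈ range (eval mem ρ e), eval mem (ρ ++ [i]) f

/-- An upper bound for the running time of the compiled expression. -/
def cost (mem : ℕ → ℕ) : List ℕ → Arith → ℕ
  | _, var _ => 2
  | _, lit _ => 1
  | ρ, add e f => cost mem ρ e + cost mem ρ f + 1
  | ρ, sub e f => cost mem ρ e + cost mem ρ f + 1
  | ρ, load e => cost mem ρ e + 1
  | ρ, ite e f g => cost mem ρ e + cost mem ρ f + cost mem ρ g + 1
  | ρ, letE e f => cost mem ρ e + cost mem (ρ ++ [eval mem ρ e]) f + 2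
  | ρ, sum e f => cost mem ρ e + (∑ i ∈ range (eval mem ρ e), (cost mem (ρ ++ [i]) f + 5)) + 3

/-- The program evaluating an expression in a context of length `d`, whose entries are in the
registers `0, 2, …, 2(d-1)`. The value is put into register `2l+1`, and the registers
`1, 3, …, 2l-1` are not changed. -/
def compile : ℕ → ℕ → Arith → Program
  | d, l, var j =>
    -- There is no move instruction, so a register is copied by adding a zero register to it.
    if j < d then .seq (.op (.const (2 * l + 3) 0)) (.op (.add (2 * l + 1) (2 * j) (2 * l + 3)))
    else .op (.const (2 * l + 1) 0)
  | _, l, lit a => .op (.const (2 * l + 1) a)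
  | d, l, add e f => .seq (compile d l e) (.seq (compile d (l + 1) f)
      (.op (.add (2 * l + 1) (2 * l + 1) (2 * l + 3))))
  | d, l, sub e f => .seq (compile d l e) (.seq (compile d (l + 1) f)
      (.op (.sub (2 * l + 1) (2 * l + 1) (2 * l + 3))))
  | d, l, load e => .seq (compile d l e) (.op (.load (2 * l + 1) (2 * l + 1)))
  | d, l, ite e f g => .seq (compile d l e) (.ite (2 * l + 1) (compile d l f) (compile d l g))
  | d, l, letE e f => .seq (compile d l e) (.seq (.op (.const (2 * l + 3) 0))
      (.seq (.op (.add (2 * d) (2 * l + 1) (2 * l + 3))) (compile (d + 1) l f)))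
  -- Register `2l+1` accumulates, `2l+3` counts down and `2d` holds the index. The body works at
  -- level `l+2` so as to spare the first two; its value in `2l+5` is then overwritten by the
  -- constant 1.
  | d, l, sum e f => .seq (compile d (l + 1) e) (.seq (.op (.const (2 * l + 1) 0))
      (.seq (.op (.const (2 * d) 0))
        (.loop (2 * l + 3) (.seq (compile (d + 1) (l + 2) f)
          (.seq (.op (.add (2 * l + 1) (2 * l + 1) (2 * l + 5)))
            (.seq (.op (.const (2 * l + 5) 1))
              (.seq (.op (.add (2 * d) (2 * d) (2 * l + 5)))
                (.op (.sub (2 * l + 3) (2 * l + 3) (2 * l + 5))))))))))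

/-- `p` computes `val` into register `2l+1` within `T` steps, keeping the memory, the context of
length `d` and the registers `1, 3, …, 2l-1`. -/
def Computes (p : Program) (d l : ℕ) (σ : State) (val T : ℕ) : Prop :=
  ∃ U ≤ T, ∃ τ, Runs p σ U τ ∧ τ.mem = σ.mem ∧ τ.reg (2 * l + 1) = val ∧
    (∀ j < d, τ.reg (2 * j) = σ.reg (2 * j)) ∧ ∀ i < l, τ.reg (2 * i + 1) = σ.reg (2 * i + 1)

/-- The registers hold the context `ρ`. -/
def Holds (ρ : List ℕ) (σ : State) : Prop := ∀ j < ρ.length, σ.reg (2 * j) = ρ.getD j 0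

theorem Holds.concat {ρ : List ℕ} {σ : State} (h : ∀ j < ρ.length, σ.reg (2 * j) = ρ.getD j 0)
    {a : ℕ} (ha : σ.reg (2 * ρ.length) = a) : Holds (ρ ++ [a]) σ := fun j hj => by
  rw [List.length_append, List.length_singleton] at hj
  rcases Nat.lt_succ_iff_lt_or_eq.mp hj with hj | rfl
  · rw [h j hj, List.getD_append _ _ _ _ hj]
  · rw [ha]; simp

/-- The loop invariant with `M` rounds to go: the index is `N - M` and the accumulator holds the
first `N - M` terms. A round costs its body, four operations and a test. -/
theorem computes_sum_loop {mem : ℕ → ℕ} {ρ : List ℕ} {l : ℕ} {f : Arith} {N : ℕ}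
    (ih : ∀ (ρ : List ℕ) (l : ℕ) (σ : State), Holds ρ σ → σ.mem = mem →
      Computes (compile ρ.length l f) ρ.length l σ (eval mem ρ f) (cost mem ρ f))
    (M : ℕ) : ∀ (σ : State), M ≤ N → (∀ j < ρ.length, σ.reg (2 * j) = ρ.getD j 0) →
      σ.mem = mem → σ.reg (2 * ρ.length) = N - M → σ.reg (2 * l + 3) = M →
      σ.reg (2 * l + 1) = ∑ i ∈ range (N - M), eval mem (ρ ++ [i]) f →
      Computes (.loop (2 * l + 3) (.seq (compile (ρ.length + 1) (l + 2) f)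
          (.seq (.op (.add (2 * l + 1) (2 * l + 1) (2 * l + 5)))
            (.seq (.op (.const (2 * l + 5) 1))
              (.seq (.op (.add (2 * ρ.length) (2 * ρ.length) (2 * l + 5)))
                (.op (.sub (2 * l + 3) (2 * l + 3) (2 * l + 5)))))))) ρ.length l σ
        (∑ i ∈ range N, eval mem (ρ ++ [i]) f)
        (∑ i ∈ Ico (N - M) N, (cost mem (ρ ++ [i]) f + 5) + 1) := by
  induction M with
  | zero =>
    intro σ _ _ _ _ h3 h1
    exact ⟨1, by simp, σ, .loop_done h3, rfl, by simpa using h1, fun _ _ => rfl, fun _ _ => rfl⟩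
  | succ M ihM =>
    intro σ hM hρ hm hd h3 h1
    have hlen : (ρ ++ [N - (M + 1)]).length = ρ.length + 1 := by simp
    obtain ⟨U, hU, τ, hrun, hτm, hτv, hτρ, hτl⟩ := ih (ρ ++ [N - (M + 1)]) (l + 2) σ
      (Holds.concat hρ hd) hm
    rw [hlen] at hrun hτρ
    have e5 : 2 * (l + 2) + 1 = 2 * l + 5 := by ring
    rw [e5] at hτv
    have r1 := hτl l (by omega)
    have r3 := hτl (l + 1) (by omega)
    have e3 : 2 * (l + 1) + 1 = 2 * l + 3 := by ring
    rw [e3, h3] at r3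
    have rd := hτρ ρ.length (by omega)
    have hsucc : N - M = N - (M + 1) + 1 := by omega
    set o1 : Op := .add (2 * l + 1) (2 * l + 1) (2 * l + 5) with ho1
    set o2 : Op := .const (2 * l + 5) 1 with ho2
    set o3 : Op := .add (2 * ρ.length) (2 * ρ.length) (2 * l + 5) with ho3
    set o4 : Op := .sub (2 * l + 3) (2 * l + 3) (2 * l + 5) with ho4
    set φ := o4.exec (o3.exec (o2.exec (o1.exec τ))) with hφ
    have hreg : ∀ i, φ.reg i = if i = 2 * l + 3 then M else if i = 2 * ρ.length then N - M else
        if i = 2 * l + 5 then 1 else if i = 2 * l + 1 then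
          σ.reg (2 * l + 1) + eval mem (ρ ++ [N - (M + 1)]) f else τ.reg i := by
      intro i
      simp only [hφ, ho1, ho2, ho3, ho4, Op.exec, Function.update_apply]
      split_ifs <;> first | rfl | omega
    have hbody := Runs.seq hrun (Runs.seq (Runs.op o1 τ) (Runs.seq (Runs.op o2 _)
      (Runs.seq (Runs.op o3 _) (Runs.op o4 _))))
    have hφm : φ.mem = mem := by rw [← hm, ← hτm]; rfl
    obtain ⟨U', hU', τ', hrun', hm', hv', hρ', hl'⟩ := ihM φ (by omega)
      (fun j hj => by
        rw [hreg, if_neg (by omega), if_neg (by omega), if_neg (by omega), if_neg (by omega),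
          hτρ j (by omega), hρ j hj]) hφm
      (by rw [hreg, if_neg (by omega), if_pos rfl]) (by rw [hreg, if_pos rfl])
      (by
        rw [hreg, if_neg (by omega), if_neg (by omega), if_neg (by omega), if_pos rfl, h1, hsucc,
          sum_range_succ])
    refine ⟨_, ?_, τ', Runs.loop_step (by omega) hbody hrun', ?_, hv', ?_, ?_⟩
    · rw [sum_eq_sum_Ico_succ_bot (by omega : N - (M + 1) < N), ← hsucc]
      omega
    · rw [hm', hφm, hm]
    · intro j hj
      rw [hρ' j hj, hreg, if_neg (by omega), if_neg (by omega), if_neg (by omega),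
        if_neg (by omega), hτρ j (by omega)]
    · intro i hi
      rw [hl' i hi, hreg, if_neg (by omega), if_neg (by omega), if_neg (by omega),
        if_neg (by omega), hτl i (by omega)]

/-- The odd registers form a stack: evaluating the second operand at level `l+1` preserves the first
one in register `2l+1`. -/
theorem computes_binary {o : ℕ → ℕ → ℕ → Op} {F : ℕ → ℕ → ℕ}
    (ho : ∀ r x y σ, (o r x y).exec σ =
      { σ with reg := Function.update σ.reg r (F (σ.reg x) (σ.reg y)) })
    {p q : Program} {d l val val' T T' : ℕ} {σ : State} (hp : Computes p d l σ val T)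
    (hq : ∀ τ : State, τ.mem = σ.mem → (∀ j < d, τ.reg (2 * j) = σ.reg (2 * j)) →
      Computes q d (l + 1) τ val' T') :
    Computes (.seq p (.seq q (.op (o (2 * l + 1) (2 * l + 1) (2 * l + 3))))) d l σ
      (F val val') (T + T' + 1) := by
  obtain ⟨U, hU, τ, h1, h2, h3, h4, h5⟩ := hp
  obtain ⟨U', hU', τ', h1', h2', h3', h4', h5'⟩ := hq τ h2 h4
  have e3 : 2 * (l + 1) + 1 = 2 * l + 3 := by ring
  rw [e3] at h3'
  refine ⟨_, ?_, _, h1.seq (h1'.seq (.op _ _)), ?_, ?_, ?_, ?_⟩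
  · omega
  · rw [ho]; exact h2'.trans h2
  · rw [ho]
    simp only [Function.update_self]
    rw [h3', h5' l (by omega), h3]
  · intro j hj
    rw [ho]
    simp only
    rw [Function.update_of_ne (by omega), h4' j hj, h4 j hj]
  · intro i hi
    rw [ho]
    simp only
    rw [Function.update_of_ne (by omega), h5' i (by omega), h5 i hi]

/-- The compiled program computes the value of the expression. -/
theorem computes_compile (e : Arith) {mem : ℕ → ℕ} : ∀ (ρ : List ℕ) (l : ℕ) (σ : State),
    Holds ρ σ → σ.mem = mem →
      Computes (compile ρ.length l e) ρ.length l σ (eval mem ρ e) (cost mem ρ e) := by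
  induction e with
  | var j =>
    intro ρ l σ hρ hm
    by_cases hj : j < ρ.length
    · rw [compile, if_pos hj]
      refine ⟨2, by simp [cost], _, .seq (.op _ _) (.op _ _), rfl, ?_, ?_, ?_⟩
      · simp [Op.exec, eval, hρ j hj, show 2 * j ≠ 2 * l + 3 by omega]
      · intro i hi
        simp [Op.exec, show 2 * i ≠ 2 * l + 3 by omega, show 2 * i ≠ 2 * l + 1 by omega]
      · intro i hi
        simp only [Op.exec]
        rw [Function.update_of_ne (by omega), Function.update_of_ne (by omega)]
    · rw [compile, if_neg hj]
      refine ⟨1, by simp [cost], _, .op _ _, rfl, ?_, ?_, ?_⟩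
      · simp [Op.exec, eval, List.getElem?_eq_none (not_lt.mp hj)]
      · intro i hi
        simp [Op.exec, show 2 * i ≠ 2 * l + 1 by omega]
      · intro i hi
        simp [Op.exec, show i ≠ l by omega]
  | lit a =>
    intro ρ l σ hρ hm
    refine ⟨1, by simp [cost], _, .op _ _, rfl, ?_, ?_, ?_⟩
    · simp [Op.exec, eval]
    · intro i hi
      simp [Op.exec, show 2 * i ≠ 2 * l + 1 by omega]
    · intro i hi
      simp [Op.exec, show i ≠ l by omega]
  | add e f ihe ihf =>
    intro ρ l σ hρ hm
    exact computes_binary (o := .add) (F := (· + ·)) (fun _ _ _ _ => rfl) (ihe ρ l σ hρ hm)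
      fun τ h1 h2 => ihf ρ (l + 1) τ (fun j hj => (h2 j hj).trans (hρ j hj)) (h1.trans hm)
  | sub e f ihe ihf =>
    intro ρ l σ hρ hm
    exact computes_binary (o := .sub) (F := (· - ·)) (fun _ _ _ _ => rfl) (ihe ρ l σ hρ hm)
      fun τ h1 h2 => ihf ρ (l + 1) τ (fun j hj => (h2 j hj).trans (hρ j hj)) (h1.trans hm)
  | load e ih =>
    intro ρ l σ hρ hm
    obtain ⟨U, hU, τ, h1, h2, h3, h4, h5⟩ := ih ρ l σ hρ hm
    refine ⟨_, ?_, _, h1.seq (.op _ _), h2, ?_, ?_, ?_⟩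
    · rw [cost]; omega
    · simp [Op.exec, eval, h3, h2, hm]
    · intro i hi
      simp [Op.exec, show 2 * i ≠ 2 * l + 1 by omega, h4 i hi]
    · intro i hi
      simp [Op.exec, show i ≠ l by omega, h5 i hi]
  | ite e f g ihe ihf ihg =>
    intro ρ l σ hρ hm
    obtain ⟨U, hU, τ, h1, h2, h3, h4, h5⟩ := ihe ρ l σ hρ hm
    have hρτ : Holds ρ τ := fun j hj => (h4 j hj).trans (hρ j hj)
    by_cases h0 : eval mem ρ e ≠ 0
    · obtain ⟨U', hU', τ', h1', h2', h3', h4', h5'⟩ := ihf ρ l τ hρτ (h2.trans hm)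
      refine ⟨_, ?_, _, h1.seq (.ite_true (by rwa [h3]) h1'), h2'.trans h2, ?_,
        fun j hj => (h4' j hj).trans (h4 j hj), fun i hi => (h5' i hi).trans (h5 i hi)⟩
      · rw [cost]; omega
      · rw [eval, if_pos h0, h3']
    · obtain ⟨U', hU', τ', h1', h2', h3', h4', h5'⟩ := ihg ρ l τ hρτ (h2.trans hm)
      refine ⟨_, ?_, _, h1.seq (.ite_false (by rw [h3]; exact not_not.mp h0) h1'), h2'.trans h2, ?_,
        fun j hj => (h4' j hj).trans (h4 j hj), fun i hi => (h5' i hi).trans (h5 i hi)⟩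
      · rw [cost]; omega
      · rw [eval, if_neg h0, h3']
  | letE e f ihe ihf =>
    intro ρ l σ hρ hm
    obtain ⟨U, hU, τ, h1, h2, h3, h4, h5⟩ := ihe ρ l σ hρ hm
    set o1 : Op := .const (2 * l + 3) 0 with ho1
    set o2 : Op := .add (2 * ρ.length) (2 * l + 1) (2 * l + 3) with ho2
    set φ := o2.exec (o1.exec τ) with hφ
    have hreg : ∀ i, φ.reg i = if i = 2 * ρ.length then eval mem ρ e else
        if i = 2 * l + 3 then 0 else τ.reg i := by
      intro i
      simp only [hφ, ho1, ho2, Op.exec, Function.update_apply]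
      split_ifs <;> first | rfl | omega
    have hlen : (ρ ++ [eval mem ρ e]).length = ρ.length + 1 := by simp
    obtain ⟨U', hU', τ', h1', h2', h3', h4', h5'⟩ := ihf (ρ ++ [eval mem ρ e]) l φ
      (Holds.concat (fun j hj => by
        rw [hreg, if_neg (by omega), if_neg (by omega), h4 j hj, hρ j hj])
        (by rw [hreg, if_pos rfl])) (h2.trans hm)
    rw [hlen] at h1' h4'
    refine ⟨_, ?_, _, h1.seq ((Runs.op o1 τ).seq ((Runs.op o2 _).seq h1')), h2'.trans h2, h3',
      fun j hj => ?_, fun i hi => ?_⟩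
    · rw [cost]; omega
    · rw [h4' j (by omega), hreg, if_neg (by omega), if_neg (by omega), h4 j hj]
    · rw [h5' i hi, hreg, if_neg (by omega), if_neg (by omega), h5 i hi]
  | sum e f ihe ihf =>
    intro ρ l σ hρ hm
    obtain ⟨U, hU, τ, h1, h2, h3, h4, h5⟩ := ihe ρ (l + 1) σ hρ hm
    have e3 : 2 * (l + 1) + 1 = 2 * l + 3 := by ring
    rw [e3] at h3
    set o1 : Op := .const (2 * l + 1) 0 with ho1
    set o2 : Op := .const (2 * ρ.length) 0 with ho2
    set φ := o2.exec (o1.exec τ) with hφ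
    have hreg : ∀ i, φ.reg i = if i = 2 * ρ.length then 0 else
        if i = 2 * l + 1 then 0 else τ.reg i := by
      intro i
      simp only [hφ, ho1, ho2, Op.exec, Function.update_apply]
    obtain ⟨U', hU', τ', h1', h2', h3', h4', h5'⟩ :=
      computes_sum_loop (N := eval mem ρ e) (ρ := ρ) (l := l) ihf (eval mem ρ e) φ le_rfl
        (fun j hj => by rw [hreg, if_neg (by omega), if_neg (by omega), h4 j hj, hρ j hj])
        (h2.trans hm) (by rw [hreg, if_pos rfl]; omega)
        (by rw [hreg, if_neg (by omega), if_neg (by omega), h3])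
        (by rw [hreg, if_neg (by omega), if_pos rfl]; simp)
    refine ⟨_, ?_, _, h1.seq ((Runs.op o1 τ).seq ((Runs.op o2 _).seq h1')), h2'.trans h2, h3',
      fun j hj => ?_, fun i hi => ?_⟩
    · rw [Nat.sub_self, ← range_eq_Ico] at hU'
      rw [cost]; omega
    · rw [h4' j (by omega), hreg, if_neg (by omega), if_neg (by omega), h4 j hj]
    · rw [h5' i hi, hreg, if_neg (by omega), if_neg (by omega), h5 i (by omega)]

end Arith

/-! ### Tabulating multiples -/

/-- With the numbers `E`, `d`, `N`, `x`, `1` in the registers `1`, `3`, `5`, `7`, `9`, the program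
stores `x, x + d, x + 2d, …, x + (N-1)d` from address `E` on. -/
def fillLoop : Program :=
  .loop 5 (.seq (.op (.store 1 7)) (.seq (.op (.add 1 1 9)) (.seq (.op (.add 7 7 3))
    (.op (.sub 5 5 9)))))

theorem runs_fillLoop (d N : ℕ) : ∀ (σ : State) (E x : ℕ), σ.reg 1 = E → σ.reg 3 = d →
    σ.reg 5 = N → σ.reg 7 = x → σ.reg 9 = 1 → ∃ τ, Runs fillLoop σ (5 * N + 1) τ ∧
      τ.mem = fun i => if E ≤ i ∧ i < E + N then x + (i - E) * d else σ.mem i := by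
  induction N with
  | zero =>
    intro σ E x _ _ h5 _ _
    refine ⟨σ, .loop_done h5, ?_⟩
    funext i
    rw [if_neg (by omega)]
  | succ N ih =>
    intro σ E x h1 h3 h5 h7 h9
    set o1 : Op := .store 1 7
    set o2 : Op := .add 1 1 9
    set o3 : Op := .add 7 7 3
    set o4 : Op := .sub 5 5 9
    have hbody := (Runs.op o1 σ).seq ((Runs.op o2 _).seq ((Runs.op o3 _).seq (Runs.op o4 _)))
    obtain ⟨τ, hτ, hm⟩ := ih (o4.exec (o3.exec (o2.exec (o1.exec σ)))) (E + 1) (x + d)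
      (by simp [o1, o2, o3, o4, Op.exec, h1, h9]) (by simp [o1, o2, o3, o4, Op.exec, h3])
      (by simp [o1, o2, o3, o4, Op.exec, h5, h9]) (by simp [o1, o2, o3, o4, Op.exec, h7, h3])
      (by simp [o1, o2, o3, o4, Op.exec, h9])
    refine ⟨τ, ?_, ?_⟩
    · have := Runs.loop_step (r := 5) (by omega) hbody hτ
      have e : 1 + (1 + (1 + 1)) + (5 * N + 1) + 1 = 5 * (N + 1) + 1 := by ring
      rwa [e] at this
    · rw [hm]
      funext i
      have hmem : (o4.exec (o3.exec (o2.exec (o1.exec σ)))).mem = Function.update σ.mem E x := by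
        simp [o1, o2, o3, o4, Op.exec, h1, h7]
      rw [hmem, Function.update_apply]
      by_cases hi : i = E
      · subst hi
        rw [if_neg (by omega), if_pos rfl, if_pos (by omega)]
        simp
      · by_cases hi2 : E + 1 ≤ i ∧ i < E + 1 + N
        · rw [if_pos hi2, if_pos (by omega)]
          obtain ⟨a, rfl⟩ := Nat.exists_eq_add_of_le hi2.1
          have e1 : E + 1 + a - (E + 1) = a := by omega
          have e2 : E + 1 + a - E = a + 1 := by omega
          rw [e1, e2]
          ring
        · rw [if_neg hi2, if_neg hi, if_neg (by omega)]

/-- Store the multiples `0, n, …, (n-1)n`, where `n` is the value of `e`, from the address which is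
the value of `f` on; then put the value of `g` into register `0`. -/
def tabulateThen (f e g : Arith) : Program :=
  -- The value of `e` is computed twice because it serves both as the increment and as the loop
  -- counter.
  .seq (f.compile 0 0) (.seq (e.compile 0 1) (.seq (e.compile 0 2) (.seq (.op (.const 7 0))
    (.seq (.op (.const 9 1)) (.seq fillLoop (.seq (g.compile 0 0)
      (.seq (.op (.const 3 0)) (.op (.add 0 1 3)))))))))

theorem runs_tabulateThen (f e g : Arith) (σ : State) (E n : ℕ) (mem : ℕ → ℕ)
    (hE : f.eval σ.mem [] = E) (hn : e.eval σ.mem [] = n)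
    (hmem : mem = fun i => if E ≤ i ∧ i < E + n then (i - E) * n else σ.mem i) :
    ∃ T τ, Runs (tabulateThen f e g) σ T τ ∧ τ.reg 0 = g.eval mem [] ∧
      T ≤ f.cost σ.mem [] + 2 * e.cost σ.mem [] + g.cost mem [] + 5 * n + 5 := by
  have hnil : ∀ τ, Arith.Holds [] τ := fun τ j hj => absurd hj (by simp)
  obtain ⟨U1, hU1, τ1, r1, m1, v1, -, -⟩ := f.computes_compile [] 0 σ (hnil _) rfl
  obtain ⟨U2, hU2, τ2, r2, m2, v2, -, f2⟩ := e.computes_compile [] 1 τ1 (hnil _) m1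
  obtain ⟨U3, hU3, τ3, r3, m3, v3, -, f3⟩ := e.computes_compile [] 2 τ2 (hnil _) (m2.trans m1)
  have a1 : τ3.reg 1 = E := by rw [f3 0 (by omega), f2 0 (by omega), ← hE]; exact v1
  have a3 : τ3.reg 3 = n := by rw [f3 1 (by omega), ← hn]; exact v2
  have a5 : τ3.reg 5 = n := by rw [← hn]; exact v3
  obtain ⟨τ4, r4, m4⟩ := runs_fillLoop n n
    ((Op.const 9 1).exec ((Op.const 7 0).exec τ3)) E 0 (by simp [Op.exec, a1])
    (by simp [Op.exec, a3]) (by simp [Op.exec, a5]) (by simp [Op.exec]) (by simp [Op.exec])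
  have m4' : τ4.mem = mem := by
    rw [m4, hmem]
    funext i
    have : ((Op.const 9 1).exec ((Op.const 7 0).exec τ3)).mem = σ.mem := m3.trans (m2.trans m1)
    rw [this, zero_add]
  obtain ⟨U5, hU5, τ5, r5, m5, v5, -, -⟩ := g.computes_compile [] 0 τ4 (hnil _) m4'
  refine ⟨_, _, r1.seq (r2.seq (r3.seq ((Runs.op _ _).seq ((Runs.op _ _).seq
    (r4.seq (r5.seq ((Runs.op _ _).seq (Runs.op _ _)))))))), ?_, ?_⟩
  · simp only [Op.exec, Function.update_self]
    rw [Function.update_of_ne (by omega)]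
    simpa using v5
  · omega

/-! ### The algorithm -/

namespace Arith

/-- Is `e ≤ f`? -/
def isLe (e f : Arith) : Arith := ite (sub e f) (lit 0) (lit 1)

/-- Is `e = f`? -/
def isEq (e f : Arith) : Arith := ite (add (sub e f) (sub f e)) (lit 0) (lit 1)

/-- The conjunction. -/
def conj (e f : Arith) : Arith := ite e f (lit 0)

/-- The entry of the adjacency matrix, with the address of the matrix in the variable `8` and
the address of the table of row addresses in the variable `9`. -/
def arc (e f : Arith) : Arith := load (add (add (var 8) f) (load (add (var 9) e)))

/-- The entry of the transposed adjacency matrix. -/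
def arcReverse (e f : Arith) : Arith := arc f e

/-- The member `e` of the middle set of the triple, whose address is the variable `7`. -/
def middle (e : Arith) : Arith := load (add (var 7) e)

/-- `outCount` of the variable `y`, in a context of length `d`. -/
def outCountE (A : Arith → Arith → Arith) (y d : ℕ) : Arith :=
  sum (var 6) (A (var y) (middle (var d)))

/-- The inner loop of `reachE`. -/
def viaE (A : Arith → Arith → Arith) : Arith :=
  sum (var 0) (conj (A (var 13) (var 15)) (conj (A (var 15) (middle (var 14)))
    (isLe (outCountE A 15 16) (var 4))))

/-- `reachCount` of the variable `13`. -/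
def reachE (A : Arith → Arith → Arith) : Arith :=
  sum (var 6) (ite (viaE A) (lit 1) (lit 0))

/-- The number of blocked in-neighbors of the variable `12`. -/
def blockedE (A : Arith → Arith → Arith) : Arith :=
  sum (var 0) (conj (A (var 13) (var 12)) (conj (isLe (outCountE A 13 14) (var 4))
    (isLe (reachE A) (var 5))))

/-- The number of the terminals that are equal to the variable `12`. -/
def terminalE : Arith :=
  sum (add (var 1) (var 1)) (isEq (load (add (lit 5) (var 13))) (var 12))

/-- Nonzero if the member of the middle set whose index is the variable `11` is a terminal or has
a blocked neighbor. -/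
def rejectedE : Arith :=
  letE (middle (var 11)) (add terminalE (add (blockedE arc) (blockedE arcReverse)))

/-- The first index that is not rejected. -/
def firstE : Arith :=
  sum (var 6) (ite (sum (add (var 10) (lit 1)) (ite rejectedE (lit 0) (lit 1))) (lit 0) (lit 1))

/-- `2 e`. -/
def double (e : Arith) : Arith := add e e

/-- The address behind the input. -/
def endE : Arith :=
  add (add (add (lit 5) (double (load (lit 1)))) (add (double (load (lit 4))) (load (lit 4))))
    (sum (load (lit 0)) (load (lit 0)))

/-- `outBound`, with `k` in the variable `1`. -/
def outBoundE : Arith := add (double (double (var 1))) (lit 1)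

/-- `reachBound`, with `k`, `h`, `outBound` in the variables `1`, `2`, `4`. -/
def reachBoundE : Arith :=
  add (sum (var 1) (add (add (double (double (var 4))) (var 2)) (lit 1))) (var 4)

/-- `tripleBound`, with `k`, `h`, `outBound`, `reachBound` in the variables `1`, `2`, `4`, `5`. -/
def tripleBoundE : Arith :=
  add (add (double (sum (var 4) (add (add (double (var 5)) (lit 1)) (var 2))))
    (double (double (double (var 1))))) (add (double (double (var 1))) (lit 2))

/-- The address of the middle set. -/
def middleAddressE : Arith := add (add (lit 5) (double (var 1))) (var 3)

/-- The address of the adjacency matrix. -/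
def matrixAddressE : Arith := add (add (var 7) (var 3)) (var 3)

/-- The address behind the adjacency matrix. -/
def tableAddressE : Arith := add (var 8) (sum (var 0) (var 0))

/-- The first member of the middle set that is not rejected. -/
def mainE : Arith :=
  letE (load (lit 0)) (letE (load (lit 1)) (letE (load (lit 2)) (letE (load (lit 4))
    (letE outBoundE (letE reachBoundE (letE tripleBoundE (letE middleAddressE
      (letE matrixAddressE (letE tableAddressE (middle firstE))))))))))

/-! ### Correctness of the expressions -/

/-- The values of the first ten variables. -/
structure Params where
  (n k h t s r m B A T : ℕ)

/-- A context that begins with the ten parameters. -/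
def Params.ctx (p : Params) (l : List ℕ) : List ℕ :=
  p.n :: p.k :: p.h :: p.t :: p.s :: p.r :: p.m :: p.B :: p.A :: p.T :: l

theorem Params.ctx_append (p : Params) (l : List ℕ) (i : ℕ) : p.ctx l ++ [i] = p.ctx (l ++ [i]) :=
  rfl

open Finset
open scoped Classical

variable {mem : ℕ → ℕ} {ρ : List ℕ} {p : Params} {A : Arith → Arith → Arith}

/-- The truth value as a number. -/
noncomputable def truth (P : Prop) : ℕ := if P then 1 else 0

theorem truth_of {P : Prop} (h : P) : truth P = 1 := if_pos h

theorem truth_of_not {P : Prop} (h : ¬ P) : truth P = 0 := if_neg h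

theorem sum_truth {N : ℕ} (P : Fin N → Prop) : ∑ i, truth (P i) = (univ.filter P).card :=
  (card_filter P univ).symm

theorem sum_truth_ne_zero {N : ℕ} (P : Fin N → Prop) : ∑ i, truth (P i) ≠ 0 ↔ ∃ i, P i := by
  simp [truth]

theorem eval_isLe (e f : Arith) :
    eval mem ρ (isLe e f) = truth (eval mem ρ e ≤ eval mem ρ f) := by
  change (if eval mem ρ e - eval mem ρ f ≠ 0 then 0 else 1) = _
  by_cases h : eval mem ρ e ≤ eval mem ρ f
  · rw [truth_of h, if_neg (by omega)]
  · rw [truth_of_not h, if_pos (by omega)]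

theorem eval_isEq (e f : Arith) :
    eval mem ρ (isEq e f) = truth (eval mem ρ e = eval mem ρ f) := by
  change (if eval mem ρ e - eval mem ρ f + (eval mem ρ f - eval mem ρ e) ≠ 0 then 0 else 1) = _
  by_cases h : eval mem ρ e = eval mem ρ f
  · rw [truth_of h, if_neg (by omega)]
  · rw [truth_of_not h, if_pos (by omega)]

theorem eval_conj {e f : Arith} {P Q : Prop} (he : eval mem ρ e = truth P)
    (hf : eval mem ρ f = truth Q) : eval mem ρ (conj e f) = truth (P ∧ Q) := by
  simp only [conj, eval, he, hf, truth]
  by_cases P <;> simp [*]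

/-- The facts about the memory that the algorithm uses. -/
structure Stored (mem : ℕ → ℕ) (p : Params) (D : Digraph (Fin p.n)) (src tgt : Fin p.k → Fin p.n)
    (b : Fin p.m → Fin p.n) : Prop where
  arc : ∀ u w : Fin p.n, mem (p.A + w + mem (p.T + u)) = truth (D.Adj u w)
  middle : ∀ j : Fin p.m, mem (p.B + j) = b j
  src : ∀ i : Fin p.k, mem (5 + i) = src i
  tgt : ∀ i : Fin p.k, mem (5 + (p.k + i)) = tgt i

/-- `A` computes the adjacency of `D`. -/
def IsArc (mem : ℕ → ℕ) (p : Params) (D : Digraph (Fin p.n)) (A : Arith → Arith → Arith) : Prop :=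
  ∀ (l : List ℕ) (e f : Arith) (u w : Fin p.n), eval mem (p.ctx l) e = u →
    eval mem (p.ctx l) f = w → eval mem (p.ctx l) (A e f) = truth (D.Adj u w)

variable {D : Digraph (Fin p.n)} {src tgt : Fin p.k → Fin p.n} {b : Fin p.m → Fin p.n}

theorem Stored.isArc (H : Stored mem p D src tgt b) : IsArc mem p D Arith.arc := by
  intro l e f u w he hf
  rw [← H.arc u w, ← he, ← hf]
  rfl

theorem Stored.isArc_reverse (H : Stored mem p D src tgt b) :
    IsArc mem p (reverse D) arcReverse := by
  intro l e f u w he hf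
  exact H.isArc l f e w u hf he

theorem eval_outCountE (hA : IsArc mem p D A) (hb : ∀ j : Fin p.m, mem (p.B + j) = b j)
    {l : List ℕ} {y d : ℕ} {x : Fin p.n} (hd : 10 + l.length = d)
    (hy : ∀ j, (p.ctx (l ++ [j])).getD y 0 = x) :
    eval mem (p.ctx l) (outCountE A y d) = outCount D b x := by
  subst hd
  change ∑ j ∈ range p.m, eval mem (p.ctx (l ++ [j])) _ = _
  rw [Finset.sum_range, outCount, ← sum_truth]
  refine sum_congr rfl fun j _ => hA _ _ _ x (b j) (hy j) ?_
  change mem (p.B + (p.ctx (l ++ [(j : ℕ)])).getD (10 + l.length) 0) = b j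
  rw [← hb j]
  congr 2
  rw [Nat.add_comm]
  simp [Params.ctx]

/-- The sum counts witnesses `w`, so only whether it vanishes carries the truth value. -/
theorem eval_viaE_ne_zero (hA : IsArc mem p D A) (hb : ∀ j : Fin p.m, mem (p.B + j) = b j)
    (i₁ i₂ i₃ : ℕ) (x : Fin p.n) (j : Fin p.m) :
    eval mem (p.ctx [i₁, i₂, i₃, x, j]) (viaE A) ≠ 0 ↔
      ∃ w, D.Adj x w ∧ D.Adj w (b j) ∧ outCount D b w ≤ p.s := by
  rw [← sum_truth_ne_zero]
  have : eval mem (p.ctx [i₁, i₂, i₃, x, j]) (viaE A) =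
      ∑ w ∈ range p.n, eval mem (p.ctx [i₁, i₂, i₃, x, j, w]) _ := rfl
  rw [this, Finset.sum_range]
  refine not_congr (Eq.congr_left (sum_congr rfl fun w _ => ?_))
  refine eval_conj (hA _ _ _ x w rfl rfl) (eval_conj
    (hA [i₁, i₂, i₃, (x : ℕ), (j : ℕ), (w : ℕ)] _ _ w (b j) rfl (hb j)) ?_)
  rw [eval_isLe, eval_outCountE (l := [i₁, i₂, i₃, (x : ℕ), (j : ℕ), (w : ℕ)]) hA hb
    (y := 15) (d := 16) (x := w) rfl fun _ => rfl]
  rfl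

theorem eval_reachE (hA : IsArc mem p D A) (hb : ∀ j : Fin p.m, mem (p.B + j) = b j)
    (i₁ i₂ i₃ : ℕ) (x : Fin p.n) :
    eval mem (p.ctx [i₁, i₂, i₃, x]) (reachE A) = reachCount D b p.s x := by
  have : eval mem (p.ctx [i₁, i₂, i₃, x]) (reachE A) =
      ∑ j ∈ range p.m, if eval mem (p.ctx [i₁, i₂, i₃, x, j]) (viaE A) ≠ 0 then 1 else 0 := rfl
  rw [this, Finset.sum_range, reachCount, ← sum_truth]
  refine sum_congr rfl fun j _ => ?_
  by_cases h : ∃ w, D.Adj x w ∧ D.Adj w (b j) ∧ outCount D b w ≤ p.s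
  · rw [truth_of h, if_pos ((eval_viaE_ne_zero hA hb _ _ _ x j).mpr h)]
  · rw [truth_of_not h, if_neg fun h' => h ((eval_viaE_ne_zero hA hb _ _ _ x j).mp h')]

theorem eval_blockedE_ne_zero (hA : IsArc mem p D A) (hb : ∀ j : Fin p.m, mem (p.B + j) = b j)
    (i₁ i₂ : ℕ) (v : Fin p.n) :
    eval mem (p.ctx [i₁, i₂, v]) (blockedE A) ≠ 0 ↔
      ∃ x, D.Adj x v ∧ Blocked D b p.s p.r x := by
  rw [← sum_truth_ne_zero]
  have : eval mem (p.ctx [i₁, i₂, v]) (blockedE A) =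
      ∑ x ∈ range p.n, eval mem (p.ctx [i₁, i₂, v, x]) _ := rfl
  rw [this, Finset.sum_range]
  refine not_congr (Eq.congr_left (sum_congr rfl fun x _ => ?_))
  refine eval_conj (hA _ _ _ x v rfl rfl) (eval_conj ?_ ?_)
  · rw [eval_isLe, eval_outCountE (l := [i₁, i₂, (v : ℕ), (x : ℕ)]) hA hb (y := 13)
      (d := 14) (x := x) rfl fun _ => rfl]
    rfl
  · rw [eval_isLe, eval_reachE hA hb]
    rfl

theorem eval_terminalE_ne_zero (H : Stored mem p D src tgt b) (i₁ i₂ : ℕ) (v : Fin p.n) :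
    eval mem (p.ctx [i₁, i₂, v]) terminalE ≠ 0 ↔ (∃ i, src i = v) ∨ ∃ i, tgt i = v := by
  have : eval mem (p.ctx [i₁, i₂, v]) terminalE = ∑ i ∈ range (p.k + p.k),
      eval mem (p.ctx [i₁, i₂, v, i]) (isEq (load (add (lit 5) (var 13))) (var 12)) := rfl
  rw [this, sum_range_add, Finset.sum_range, Finset.sum_range, ← sum_truth_ne_zero,
    ← sum_truth_ne_zero (fun i => tgt i = v), Ne, Nat.add_eq_zero_iff, not_and_or]
  refine or_congr (not_congr (Eq.congr_left (sum_congr rfl fun i _ => ?_)))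
    (not_congr (Eq.congr_left (sum_congr rfl fun i _ => ?_)))
  · rw [eval_isEq]
    change truth (mem (5 + i) = v) = _
    rw [H.src, Fin.val_inj]
  · rw [eval_isEq]
    change truth (mem (5 + (p.k + i)) = v) = _
    rw [H.tgt, Fin.val_inj]

/-- The members of the middle set that the algorithm does not accept. -/
def Rejected (D : Digraph (Fin p.n)) (src tgt : Fin p.k → Fin p.n) (b : Fin p.m → Fin p.n)
    (o : Fin p.m) : Prop :=
  ((∃ i, src i = b o) ∨ ∃ i, tgt i = b o) ∨ (∃ x, D.Adj x (b o) ∧ Blocked D b p.s p.r x) ∨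
    ∃ x, (reverse D).Adj x (b o) ∧ Blocked (reverse D) b p.s p.r x

theorem eval_rejectedE_ne_zero (H : Stored mem p D src tgt b) (i : ℕ) (o : Fin p.m) :
    eval mem (p.ctx [i, o]) rejectedE ≠ 0 ↔ Rejected D src tgt b o := by
  have : eval mem (p.ctx [i, o]) rejectedE = eval mem (p.ctx [i, o, b o])
      (add terminalE (add (blockedE Arith.arc) (blockedE arcReverse))) := by
    rw [← H.middle o]
    rfl
  rw [this, eval, eval, Ne, Nat.add_eq_zero_iff, Nat.add_eq_zero_iff, not_and_or, not_and_or,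
    ← Ne, ← Ne, ← Ne, eval_terminalE_ne_zero H, eval_blockedE_ne_zero H.isArc H.middle,
    eval_blockedE_ne_zero H.isArc_reverse H.middle]
  rfl

/-- `firstE` counts the `i` such that all `j ≤ i` are rejected. These are exactly the `i < o`. -/
theorem eval_firstE (H : Stored mem p D src tgt b) {o : Fin p.m} (ho : ¬ Rejected D src tgt b o)
    (hmin : ∀ j < o, Rejected D src tgt b j) : eval mem (p.ctx []) firstE = o := by
  have h1 : eval mem (p.ctx []) firstE = ∑ i ∈ range p.m,
      if (∑ j ∈ range (i + 1), if eval mem (p.ctx [i, j]) rejectedE ≠ 0 then 0 else 1) ≠ 0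
      then 0 else 1 := rfl
  have h2 : ∀ i ∈ range p.m,
      (if (∑ j ∈ range (i + 1), if eval mem (p.ctx [i, j]) rejectedE ≠ 0 then 0 else 1) ≠ 0
        then 0 else 1) = if i < o then 1 else 0 := by
    intro i hi
    have hi := mem_range.mp hi
    by_cases hio : i < o
    · rw [if_pos hio, if_neg]
      rw [not_not]
      refine sum_eq_zero fun j hj => ?_
      have hj := mem_range.mp hj
      rw [if_pos]
      exact (eval_rejectedE_ne_zero H i ⟨j, by omega⟩).mpr
        (hmin _ (Fin.lt_def.mpr (by simp only; omega)))
    · rw [if_neg hio, if_pos]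
      intro h0
      have := sum_eq_zero_iff.mp h0 o (mem_range.mpr (by omega))
      rw [if_neg] at this
      · exact one_ne_zero this
      · rw [eval_rejectedE_ne_zero H]
        exact ho
  rw [h1, sum_congr rfl h2, ← card_filter]
  have h3 : (range p.m).filter (· < (o : ℕ)) = range o := by
    ext i
    simp only [mem_filter, mem_range]
    have := o.2
    omega
  rw [h3, card_range]

/-! ### The running time -/

/-- The cost of `A e f` exceeds that of `e` and `f` by `9`. -/
def ArcCost (mem : ℕ → ℕ) (A : Arith → Arith → Arith) : Prop :=
  ∀ ρ e f, cost mem ρ (A e f) = cost mem ρ e + cost mem ρ f + 9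

theorem arcCost_arc : ArcCost mem arc := fun ρ e f => by
  simp only [arc, cost]; omega

theorem arcCost_arcReverse : ArcCost mem arcReverse := fun ρ e f => by
  simp only [arcReverse, arc, cost]; omega

theorem cost_middle (e : Arith) : cost mem ρ (middle e) = cost mem ρ e + 4 := by
  simp only [middle, cost]; omega

theorem cost_isLe (e f : Arith) : cost mem ρ (isLe e f) = cost mem ρ e + cost mem ρ f + 4 := by
  simp only [isLe, cost]

theorem cost_conj (e f : Arith) : cost mem ρ (conj e f) = cost mem ρ e + cost mem ρ f + 2 := by
  simp only [conj, cost]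

theorem cost_sum_le {e f : Arith} {N X : ℕ} (hN : eval mem ρ e = N)
    (h : ∀ i < N, cost mem (ρ ++ [i]) f ≤ X) :
    cost mem ρ (sum e f) ≤ cost mem ρ e + N * (X + 5) + 3 := by
  rw [cost, hN]
  have : ∑ i ∈ range N, (cost mem (ρ ++ [i]) f + 5) ≤ ∑ _i ∈ range N, (X + 5) :=
    sum_le_sum fun i hi => Nat.add_le_add_right (h i (mem_range.mp hi)) 5
  rw [sum_const, card_range, smul_eq_mul] at this
  omega

theorem cost_outCountE_le (hA : ArcCost mem A) (l : List ℕ) (y d : ℕ) :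
    cost mem (p.ctx l) (outCountE A y d) ≤ 22 * p.m + 5 := by
  refine (cost_sum_le (N := p.m) rfl (X := 17) fun i _ => ?_).trans ?_
  · rw [hA, cost_middle, cost, cost]
  · simp only [cost]; omega

theorem cost_viaE_le (hA : ArcCost mem A) (l : List ℕ) :
    cost mem (p.ctx l) (viaE A) ≤ p.n * (22 * p.m + 50) + 5 := by
  refine (cost_sum_le (N := p.n) rfl (X := 22 * p.m + 45) fun i _ => ?_).trans ?_
  · have := cost_outCountE_le (p := p) hA (l ++ [i]) 15 16
    rw [Params.ctx_append, cost_conj, cost_conj, cost_isLe, hA, hA, cost_middle]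
    simp only [cost]
    omega
  · simp only [cost, Nat.add_assoc, Nat.reduceAdd]; omega

theorem cost_reachE_le (hA : ArcCost mem A) (l : List ℕ) :
    cost mem (p.ctx l) (reachE A) ≤ p.m * (p.n * (22 * p.m + 50) + 13) + 5 := by
  refine (cost_sum_le (N := p.m) rfl (X := p.n * (22 * p.m + 50) + 8) fun i _ => ?_).trans ?_
  · have := cost_viaE_le (p := p) hA (l ++ [i])
    rw [Params.ctx_append]
    simp only [cost]
    omega
  · simp only [cost, Nat.add_assoc, Nat.reduceAdd]; omega

theorem cost_blockedE_le (hA : ArcCost mem A) (l : List ℕ) (hn : 1 ≤ p.n) (hm : 1 ≤ p.m) :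
    cost mem (p.ctx l) (blockedE A) ≤ 200 * (p.n ^ 2 * p.m ^ 2) := by
  refine (cost_sum_le (N := p.n) rfl
    (X := p.m * (p.n * (22 * p.m + 50) + 13) + 22 * p.m + 39) fun i _ => ?_).trans ?_
  · have h1 := cost_outCountE_le (p := p) hA (l ++ [i]) 13 14
    have h2 := cost_reachE_le (p := p) hA (l ++ [i])
    rw [Params.ctx_append, cost_conj, cost_conj, cost_isLe, cost_isLe, hA]
    simp only [cost]
    omega
  · simp only [cost]
    obtain ⟨a, ha⟩ := Nat.exists_eq_add_of_le hn
    obtain ⟨c, hc⟩ := Nat.exists_eq_add_of_le hm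
    rw [ha, hc]
    ring_nf
    omega

theorem cost_terminalE (l : List ℕ) :
    cost mem (p.ctx l) terminalE ≤ 100 * p.k + 100 := by
  refine (cost_sum_le (N := p.k + p.k) rfl (X := 30) fun i _ => ?_).trans ?_
  · simp only [isEq, cost]; omega
  · simp only [cost]; omega

theorem cost_rejectedE_le (l : List ℕ) (hn : 1 ≤ p.n) (hm : 1 ≤ p.m) (hk : p.k ≤ p.m) :
    cost mem (p.ctx l) rejectedE ≤ 700 * (p.n ^ 2 * p.m ^ 2) := by
  rw [rejectedE, cost, Params.ctx_append, cost, cost, cost_middle]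
  simp only [cost]
  have h1 := cost_terminalE (mem := mem) (p := p) (l ++ [eval mem (p.ctx l) (middle (var 11))])
  have h2 := cost_blockedE_le (mem := mem) (p := p) arcCost_arc
    (l ++ [eval mem (p.ctx l) (middle (var 11))]) hn hm
  have h3 := cost_blockedE_le (mem := mem) (p := p) arcCost_arcReverse
    (l ++ [eval mem (p.ctx l) (middle (var 11))]) hn hm
  have h4 : 1 * p.m ≤ p.n ^ 2 * p.m ^ 2 :=
    Nat.mul_le_mul (Nat.one_le_pow _ _ hn) (Nat.le_self_pow (by omega) _)
  omega

/-- For every `i` all `j ≤ i` are tested anew, which makes `O(m²)` tests of cost `O(n² m²)`. -/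
theorem cost_firstE_le (hn : 1 ≤ p.n) (hm : 1 ≤ p.m) (hk : p.k ≤ p.m) :
    cost mem (p.ctx []) firstE ≤ 1000 * (p.n ^ 2 * p.m ^ 4) := by
  have hX : 1 ≤ p.n ^ 2 * p.m ^ 2 := Nat.mul_pos (Nat.pow_pos hn) (Nat.pow_pos hm)
  have hX1 : p.n ^ 2 * p.m ^ 2 * 1 ≤ p.n ^ 2 * p.m ^ 2 * p.m := Nat.mul_le_mul_left _ hm
  have hX2 : p.n ^ 2 * p.m ^ 2 * p.m * 1 ≤ p.n ^ 2 * p.m ^ 2 * p.m * p.m :=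
    Nat.mul_le_mul_left _ hm
  refine (cost_sum_le (N := p.m) rfl (X := 720 * (p.n ^ 2 * p.m ^ 2 * p.m))
    fun i hi => ?_).trans ?_
  · rw [Params.ctx_append, cost]
    have h1 : cost mem (p.ctx ([] ++ [i]))
        (sum (add (var 10) (lit 1)) (ite rejectedE (lit 0) (lit 1))) ≤ _ :=
      cost_sum_le (N := i + 1) rfl (X := 700 * (p.n ^ 2 * p.m ^ 2) + 3) fun j _ => by
        have := cost_rejectedE_le (mem := mem) (p := p) ([] ++ [i] ++ [j]) hn hm hk
        rw [Params.ctx_append, cost, cost, cost]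
        omega
    simp only [cost] at h1 ⊢
    have h2 : (i + 1) * (700 * (p.n ^ 2 * p.m ^ 2) + 3 + 5) ≤
        p.m * (708 * (p.n ^ 2 * p.m ^ 2)) := Nat.mul_le_mul hi (by omega)
    have h3 : p.m * (708 * (p.n ^ 2 * p.m ^ 2)) = 708 * (p.n ^ 2 * p.m ^ 2 * p.m) := by ring
    omega
  · simp only [cost]
    have h2 : p.m * (720 * (p.n ^ 2 * p.m ^ 2 * p.m) + 5) ≤
        p.m * (725 * (p.n ^ 2 * p.m ^ 2 * p.m)) := Nat.mul_le_mul_left _ (by omega)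
    have h3 : p.m * (725 * (p.n ^ 2 * p.m ^ 2 * p.m)) =
        725 * (p.n ^ 2 * p.m ^ 2 * p.m * p.m) := by ring
    have h4 : p.n ^ 2 * p.m ^ 4 = p.n ^ 2 * p.m ^ 2 * p.m * p.m := by ring
    omega

/-! ### The complete expression -/

/-- The parameters of an instance. -/
def params (n k h t : ℕ) : Params where
  n := n
  k := k
  h := h
  t := t
  s := outBound k
  r := reachBound k h
  m := tripleBound k h
  B := 5 + (k + k) + t
  A := 5 + (k + k) + t + t + t
  T := 5 + (k + k) + t + t + t + n * n

/-- Products are encoded as sums of a constant term, and doubling as addition; `hs`, `hr` and `hm`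
identify the resulting polynomials with the bounds. -/
theorem eval_mainE {n k h t : ℕ} (h0 : mem 0 = n) (h1 : mem 1 = k) (h2 : mem 2 = h)
    (h4 : mem 4 = t) :
    eval mem [] mainE = mem ((params n k h t).B + eval mem ((params n k h t).ctx []) firstE) := by
  have hs : k + k + (k + k) + 1 = outBound k := by unfold outBound; ring
  have hr : k * (outBound k + outBound k + (outBound k + outBound k) + h + 1) + outBound k =
      reachBound k h := by unfold reachBound outBound; ring
  have hm : outBound k * (reachBound k h + reachBound k h + 1 + h) +
      outBound k * (reachBound k h + reachBound k h + 1 + h) +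
      (k + k + (k + k) + (k + k + (k + k))) + (k + k + (k + k) + 2) = tripleBound k h := by
    unfold tripleBound; ring
  simp only [mainE, eval, h0, h1, h2, h4, outBoundE, reachBoundE, tripleBoundE, middleAddressE,
    matrixAddressE, tableAddressE, middle, double, List.nil_append, List.cons_append,
    List.getD_cons_zero, List.getD_cons_succ, sum_const, card_range, smul_eq_mul, hs, hr, hm]
  rfl

theorem cost_mainE_le {n k h t : ℕ} (h0 : mem 0 = n) (h1 : mem 1 = k) (h2 : mem 2 = h)
    (h4 : mem 4 = t) (hn : 1 ≤ n) :
    cost mem [] mainE ≤ 2000 * (n ^ 2 * tripleBound k h ^ 4) := by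
  have hs : k + k + (k + k) + 1 = outBound k := by unfold outBound; ring
  have hr : k * (outBound k + outBound k + (outBound k + outBound k) + h + 1) + outBound k =
      reachBound k h := by unfold reachBound outBound; ring
  have hm : outBound k * (reachBound k h + reachBound k h + 1 + h) +
      outBound k * (reachBound k h + reachBound k h + 1 + h) +
      (k + k + (k + k) + (k + k + (k + k))) + (k + k + (k + k) + 2) = tripleBound k h := by
    unfold tripleBound; ring
  have hkm : 12 * k + 2 ≤ tripleBound k h := by unfold tripleBound; omega
  have hsm : outBound k ≤ tripleBound k h := by unfold outBound; omega
  have hfirst := cost_firstE_le (mem := mem) (p := params n k h t) hn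
    (by change 1 ≤ tripleBound k h; omega) (by change k ≤ tripleBound k h; omega)
  change cost mem _ firstE ≤ 1000 * (n ^ 2 * tripleBound k h ^ 4) at hfirst
  have h5 : n * 1 ≤ n ^ 2 * tripleBound k h ^ 4 :=
    Nat.mul_le_mul (Nat.le_self_pow (by omega) _) (Nat.one_le_pow _ _ (by omega))
  have h6 : 1 * tripleBound k h ≤ n ^ 2 * tripleBound k h ^ 4 :=
    Nat.mul_le_mul (Nat.one_le_pow _ _ hn) (Nat.le_self_pow (by omega) _)
  simp only [mainE, eval, cost, h0, h1, h2, h4, outBoundE, reachBoundE, tripleBoundE,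
    middleAddressE, matrixAddressE, tableAddressE, middle, double, List.nil_append,
    List.cons_append, List.getD_cons_zero, List.getD_cons_succ, sum_const, card_range,
    smul_eq_mul, hs, hr, hm]
  generalize hX : cost mem _ firstE = X
  have hX' := hX.symm.trans_le hfirst
  omega

end Arith

/-! ### Reading the input -/

theorem getD_ofFn {N : ℕ} (f : Fin N → ℕ) (i : Fin N) : (List.ofFn f).getD i 0 = f i := by
  rw [List.getD_eq_getElem _ _ (by simp), List.getElem_ofFn]

theorem getD_append_add (l l' : List ℕ) {N i : ℕ} (hN : l.length = N) :
    (l ++ l').getD (N + i) 0 = l'.getD i 0 := by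
  rw [List.getD_append_right _ _ _ _ (by omega), hN, Nat.add_sub_cancel_left]

theorem IsTriple.restrict {V : Type*} {D : Digraph V} {t m : ℕ} {a b g : Fin t → V}
    (hT : IsTriple D a b g) {φ : Fin m → Fin t} (hφ : Function.Injective φ) :
    IsTriple D (a ∘ φ) (b ∘ φ) (g ∘ φ) where
  injA := hT.injA.comp hφ
  injB := hT.injB.comp hφ
  injC := hT.injC.comp hφ
  disjAB := hT.disjAB.mono (Set.range_comp_subset_range _ _) (Set.range_comp_subset_range _ _)
  disjBC := hT.disjBC.mono (Set.range_comp_subset_range _ _) (Set.range_comp_subset_range _ _)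
  disjAC := hT.disjAC.mono (Set.range_comp_subset_range _ _) (Set.range_comp_subset_range _ _)
  arcAB _ _ := hT.arcAB _ _
  arcBC _ _ := hT.arcBC _ _
  arcCA _ := hT.arcCA _

section Encode

variable {n k t : ℕ} (h c : ℕ) (D : Digraph (Fin n)) (src tgt : Fin k → Fin n)
  (a b g : Fin t → Fin n)

theorem length_vertexList {m : ℕ} (x : Fin m → Fin n) : (vertexList x).length = m := by
  simp [vertexList]

theorem getD_encode_src (i : Fin k) : (encode h c D src tgt a b g).getD (5 + i) 0 = src i := by
  simp only [encode, List.append_assoc]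
  rw [getD_append_add _ _ (N := 5) rfl,
    List.getD_append _ _ _ _ (by rw [length_vertexList]; exact i.2)]
  exact getD_ofFn _ i

theorem getD_encode_tgt (i : Fin k) :
    (encode h c D src tgt a b g).getD (5 + (k + i)) 0 = tgt i := by
  simp only [encode, List.append_assoc]
  rw [getD_append_add _ _ (N := 5) rfl, getD_append_add _ _ (length_vertexList _),
    List.getD_append _ _ _ _ (by rw [length_vertexList]; exact i.2)]
  exact getD_ofFn _ i

theorem getD_encode_middle (j : Fin t) :
    (encode h c D src tgt a b g).getD (5 + (k + k) + t + j) 0 = b j := by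
  simp only [encode, List.append_assoc, Nat.add_assoc]
  rw [getD_append_add _ _ (N := 5) rfl, getD_append_add _ _ (length_vertexList _),
    getD_append_add _ _ (length_vertexList _), getD_append_add _ _ (length_vertexList _),
    List.getD_append _ _ _ _ (by rw [length_vertexList]; exact j.2)]
  exact getD_ofFn _ j

theorem getD_encode_matrix (u w : Fin n) :
    (encode h c D src tgt a b g).getD (5 + (k + k) + t + t + t + w + u * n) 0 =
      Arith.truth (D.Adj u w) := by
  simp only [encode, List.append_assoc, Nat.add_assoc]
  rw [getD_append_add _ _ (N := 5) rfl, getD_append_add _ _ (length_vertexList _),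
    getD_append_add _ _ (length_vertexList _), getD_append_add _ _ (length_vertexList _),
    getD_append_add _ _ (length_vertexList _), getD_append_add _ _ (length_vertexList _)]
  have hlt : (w : ℕ) + u * n < n * n := by
    have h1 := Nat.mul_le_mul_right n (Nat.succ_le_of_lt u.2)
    have h2 := w.2
    rw [Nat.succ_mul] at h1
    omega
  have key := getD_ofFn (fun x : Fin (n * n) => Arith.truth (D.Adj x.divNat x.modNat)) ⟨_, hlt⟩
  have h1 : (⟨_, hlt⟩ : Fin (n * n)).divNat = u := Fin.ext (by
    have := w.2
    simp only [Fin.divNat]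
    rw [Nat.add_mul_div_right _ _ (by omega), Nat.div_eq_of_lt w.2, zero_add])
  have h2 : (⟨_, hlt⟩ : Fin (n * n)).modNat = w := Fin.ext (by
    simp only [Fin.modNat]
    rw [Nat.add_mul_mod_self_right, Nat.mod_eq_of_lt w.2])
  rw [h1, h2] at key
  exact key

end Encode

/-! ### The complete program -/

/-- The program. -/
def findIrrelevant : Program := tabulateThen Arith.endE (.load (.lit 0)) Arith.mainE

/-- The memory after the table of row addresses has been stored. -/
def tabulated (mem : ℕ → ℕ) (E n : ℕ) : ℕ → ℕ :=
  fun i => if E ≤ i ∧ i < E + n then (i - E) * n else mem i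

theorem tabulated_of_lt {mem : ℕ → ℕ} {E n i : ℕ} (hi : i < E) : tabulated mem E n i = mem i :=
  if_neg (by omega)

/-- The table starts right behind the input, so it does not disturb it. Only the first `tripleBound
k h` members of the triple are used. -/
theorem stored_tabulated {n k h c t : ℕ} (D : Digraph (Fin n)) (src tgt : Fin k → Fin n)
    (a b g : Fin t → Fin n) {φ : Fin (tripleBound k h) → Fin t}
    (hφ : ∀ j, (φ j : ℕ) = j) :
    Arith.Stored (tabulated (State.init (encode h c D src tgt a b g)).mem
      (5 + (k + k) + t + t + t + n * n) n) (Arith.params n k h t) D src tgt (b ∘ φ) where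
  arc := fun (u w : Fin n) => by
    change tabulated _ _ n (5 + (k + k) + t + t + t + w +
      tabulated _ _ n (5 + (k + k) + t + t + t + n * n + u)) = _
    have hu : tabulated (State.init (encode h c D src tgt a b g)).mem
        (5 + (k + k) + t + t + t + n * n) n (5 + (k + k) + t + t + t + n * n + u) = u * n := by
      rw [tabulated, if_pos ⟨Nat.le_add_right _ _, Nat.add_lt_add_left u.2 _⟩,
        Nat.add_sub_cancel_left]
    have h1 := Nat.mul_le_mul_right n (Nat.succ_le_of_lt u.2)
    rw [Nat.succ_mul] at h1
    have h2 : (w : ℕ) < n := w.2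
    rw [hu, tabulated_of_lt (by omega)]
    exact getD_encode_matrix h c D src tgt a b g u w
  middle := fun (j : Fin (tripleBound k h)) => by
    have h1 := (φ j).2
    rw [hφ] at h1
    change tabulated _ _ n (5 + (k + k) + t + (j : ℕ)) = _
    rw [tabulated_of_lt (by omega), ← hφ j]
    exact getD_encode_middle h c D src tgt a b g (φ j)
  src i := by
    have h1 : (i : ℕ) < k := i.2
    rw [tabulated_of_lt (by omega)]
    exact getD_encode_src h c D src tgt a b g i
  tgt i := by
    have h1 : (i : ℕ) < k := i.2
    change tabulated _ _ n (5 + (k + (i : ℕ))) = _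
    rw [tabulated_of_lt (by omega)]
    exact getD_encode_tgt h c D src tgt a b g i

/-- Given an instance and a sufficiently large triple, the program finds an irrelevant vertex. -/
theorem runs_findIrrelevant {n k h c t : ℕ} {D : Digraph (Fin n)} {src tgt : Fin k → Fin n}
    {a b g : Fin t → Fin n} (ht : tripleBound k h ≤ t) (hkc : k < 2 * c)
    (hD : IsSemicomplete h D) (hT : IsTriple D a b g) :
    ∃ (v : Fin n) (T : ℕ) (τ : State), IsIrrelevant D src tgt c v ∧
      Runs findIrrelevant (State.init (encode h c D src tgt a b g)) T τ ∧ τ.reg 0 = v ∧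
      T ≤ 3000 * (n ^ 2 * tripleBound k h ^ 4) := by
  classical
  set φ : Fin (tripleBound k h) → Fin t := Fin.castLE ht
  have hm : 12 * k + 2 ≤ tripleBound k h := by unfold tripleBound; omega
  have hn : 1 ≤ n := by
    have := (b ⟨0, by omega⟩).2
    omega
  have hT' := hT.restrict (φ := φ) (Fin.castLE_injective ht)
  have H := stored_tabulated (c := c) D src tgt a b g (φ := φ) fun _ => rfl
  obtain ⟨T, τ, hrun, hreg, hle⟩ := runs_tabulateThen Arith.endE (.load (.lit 0)) Arith.mainE
    (State.init (encode h c D src tgt a b g)) (5 + (k + k) + t + t + t + n * n) n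
    (tabulated (State.init (encode h c D src tgt a b g)).mem (5 + (k + k) + t + t + t + n * n) n)
    (by
      have h0 : (State.init (encode h c D src tgt a b g)).mem 0 = n := rfl
      have h1 : (State.init (encode h c D src tgt a b g)).mem 1 = k := rfl
      have h4 : (State.init (encode h c D src tgt a b g)).mem 4 = t := rfl
      simp only [Arith.endE, Arith.double, Arith.eval, h0, h1, h4, Finset.sum_const,
        Finset.card_range, smul_eq_mul]
      omega) rfl rfl
  have h0 : tabulated (State.init (encode h c D src tgt a b g)).mem
      (5 + (k + k) + t + t + t + n * n) n 0 = n := by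
    rw [tabulated_of_lt (by omega)]; rfl
  have h1 : tabulated (State.init (encode h c D src tgt a b g)).mem
      (5 + (k + k) + t + t + t + n * n) n 1 = k := by
    rw [tabulated_of_lt (by omega)]; rfl
  have h2 : tabulated (State.init (encode h c D src tgt a b g)).mem
      (5 + (k + k) + t + t + t + n * n) n 2 = h := by
    rw [tabulated_of_lt (by omega)]; rfl
  have h4 : tabulated (State.init (encode h c D src tgt a b g)).mem
      (5 + (k + k) + t + t + t + n * n) n 4 = t := by
    rw [tabulated_of_lt (by omega)]; rfl
  have hex : ∃ o, ¬ Arith.Rejected (p := Arith.params n k h t) D src tgt (b ∘ φ) o := by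
    obtain ⟨o, ho1, ho2, ho3, ho4⟩ := exists_not_blocked hT'.injB hD le_rfl src tgt
    refine ⟨o, ?_⟩
    rintro ((⟨i, hi⟩ | ⟨i, hi⟩) | ⟨x, hx, hx'⟩ | ⟨x, hx, hx'⟩)
    exacts [ho1 i hi, ho2 i hi, ho3 x hx hx', ho4 x hx hx']
  obtain ⟨o, ho, hmin⟩ : ∃ o, ¬ Arith.Rejected (p := Arith.params n k h t) D src tgt (b ∘ φ) o ∧
      ∀ j < o, Arith.Rejected (p := Arith.params n k h t) D src tgt (b ∘ φ) j := by
    obtain ⟨o, ho, hmin⟩ := (Set.toFinite {o | ¬ Arith.Rejected (p := Arith.params n k h t) D src tgt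
      (b ∘ φ) o}).exists_minimal hex
    exact ⟨o, ho, fun j hj => by_contra fun hn => absurd (hmin hn hj.le) (not_le.mpr hj)⟩
  refine ⟨b (φ o), T, τ, ?_, hrun, ?_, ?_⟩
  · refine isIrrelevant_of_not_blocked hT' hD hkc (by omega) (o := o) ?_ ?_ ?_ ?_
    · exact fun i hi => ho (.inl (.inl ⟨i, hi⟩))
    · exact fun i hi => ho (.inl (.inr ⟨i, hi⟩))
    · exact fun x hx hx' => ho (.inr (.inl ⟨x, hx, hx'⟩))
    · exact fun x hx hx' => ho (.inr (.inr ⟨x, hx, hx'⟩))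
  · rw [hreg, Arith.eval_mainE h0 h1 h2 h4, Arith.eval_firstE H ho hmin]
    exact H.middle o
  · have hmain := Arith.cost_mainE_le h0 h1 h2 h4 hn
    have hn2 : n * 1 ≤ n ^ 2 * tripleBound k h ^ 4 :=
      Nat.mul_le_mul (Nat.le_self_pow (by omega) _) (Nat.one_le_pow _ _ (by omega))
    have hend : Arith.cost (State.init (encode h c D src tgt a b g)).mem [] Arith.endE ≤
        7 * n + 28 := by
      have h0 : (State.init (encode h c D src tgt a b g)).mem 0 = n := rfl
      simp only [Arith.endE, Arith.double, Arith.eval, Arith.cost, h0, Finset.sum_const,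
        Finset.card_range, smul_eq_mul]
      omega
    have hload : Arith.cost (State.init (encode h c D src tgt a b g)).mem []
        (.load (.lit 0)) = 2 := rfl
    omega

/-! ### Growth of the bound -/

theorem tripleBound_zero_le {k : ℕ} (hk : 1 ≤ k) : tripleBound k 0 ≤ 600 * k ^ 3 := by
  obtain ⟨j, rfl⟩ := Nat.exists_eq_add_of_le hk
  unfold tripleBound outBound reachBound
  ring_nf
  omega

/-- The right-hand side is `k ^ (k log 2)`, and `9 log 2 > 6`. -/
theorem pow_six_le {k : ℕ} (hk : 9 ≤ k) :
    (k : ℝ) ^ 6 ≤ (2 : ℝ) ^ ((k : ℝ) * Real.log (k : ℝ)) := by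
  have hk' : (9 : ℝ) ≤ k := by exact_mod_cast hk
  have hlog : 0 ≤ Real.log k := Real.log_nonneg (by linarith)
  have h2 := Real.log_two_gt_d9
  rw [Real.rpow_def_of_pos two_pos, ← Real.exp_log (by positivity : (0 : ℝ) < (k : ℝ) ^ 6),
    Real.log_pow, Real.exp_le_exp]
  have : (6 : ℝ) ≤ Real.log 2 * k := by nlinarith
  calc ((6 : ℕ) : ℝ) * Real.log k ≤ (Real.log 2 * k) * Real.log k :=
        mul_le_mul_of_nonneg_right (by exact_mod_cast this) hlog
    _ = Real.log 2 * (k * Real.log k) := by ring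

end DDP

/-- There are a function `f`, one program and one constant `C` such that, for all `k ≥ 1` and `h`,
`f k h ≥ 1` and the program, given an instance of `(k,c)`-DDP with `2c > k` on a simple
`h`-semicomplete digraph with vertex set `{0, …, n-1}` and an `f k h`-triple of this digraph,
outputs (in register `0`) an irrelevant vertex after at most `C * (f k h)² * n²` steps; moreover
`f k 0 = O(2 ^ (k log k))` (with the natural logarithm). -/
theorem theorem4 :
    ∃ (f : ℕ → ℕ → ℕ) (prog : DDP.Program) (C : ℕ),
      (∀ k h : ℕ, 1 ≤ k → 1 ≤ f k h ∧
        ∀ (c n : ℕ) (D : Digraph (Fin n)) (src tgt : Fin k → Fin n)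
          (a b g : Fin (f k h) → Fin n),
          k < 2 * c → DDP.Simple D → DDP.IsSemicomplete h D → DDP.IsTriple D a b g →
          ∃ (v : Fin n) (T : ℕ) (τ : DDP.State),
            DDP.IsIrrelevant D src tgt c v ∧
            DDP.Runs prog (DDP.State.init (DDP.encode h c D src tgt a b g)) T τ ∧
            τ.reg 0 = (v : ℕ) ∧
            T ≤ C * (f k h) ^ 2 * n ^ 2) ∧
      (fun k : ℕ => (f k 0 : ℝ)) =O[Filter.atTop]
        (fun k : ℕ => (2 : ℝ) ^ ((k : ℝ) * Real.log (k : ℝ))) := by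
  -- Squaring turns the factor `tripleBound k h ^ 4` of the running time into `f k h ^ 2`.
  refine ⟨fun k h => DDP.tripleBound k h ^ 2, DDP.findIrrelevant, 3000, fun k h _ => ⟨?_, ?_⟩, ?_⟩
  · exact Nat.one_le_pow _ _ (by unfold DDP.tripleBound; omega)
  · intro c n D src tgt a b g hkc _ hD hT
    obtain ⟨v, T, τ, h1, h2, h3, h4⟩ := DDP.runs_findIrrelevant (src := src) (tgt := tgt)
      (Nat.le_self_pow two_ne_zero _) hkc hD hT
    refine ⟨v, T, τ, h1, h2, h3, h4.trans (le_of_eq ?_)⟩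
    ring
  · refine Asymptotics.IsBigO.of_bound (600 ^ 2) (Filter.eventually_atTop.mpr ⟨9, fun k hk => ?_⟩)
    have h1 : ((DDP.tripleBound k 0 : ℕ) : ℝ) ≤ 600 * (k : ℝ) ^ 3 := by
      exact_mod_cast DDP.tripleBound_zero_le (by omega)
    rw [Real.norm_of_nonneg (by positivity), Real.norm_of_nonneg (by positivity)]
    calc ((DDP.tripleBound k 0 ^ 2 : ℕ) : ℝ) = (DDP.tripleBound k 0 : ℝ) ^ 2 := by push_cast; ring
      _ ≤ (600 * (k : ℝ) ^ 3) ^ 2 := by gcongr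
      _ = 600 ^ 2 * (k : ℝ) ^ 6 := by ring
      _ ≤ _ := by gcongr; exact DDP.pow_six_le hk
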